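/- Let $n\ge 1$, $L>0$, and let $a_0,\dots,a_n:[0,L]\to\mathbb C$ be continuous (for instance smooth) with $a_n(x)\neq 0$ for all $x\in[0,L]$. Let $\mathcal L u=\sum_{j=0}^{n}a_j u^{(j)}$ be the operator on $L^2([0,L];\mathbb C)$ whose domain consists of all $u\in H^n(0,L)$ such that $\mathbf u=(u,u',\dots,u^{(n-1)})^T$ satisfies one of the following boundary conditions: * separated: $B_L\mathbf u(0)=0$ and $B_R\mathbf u(L)=0$, where $B_L\in\mathbb C^{k\times n}$ and $B_R\in\mathbb C^{(n-k)\times n}$ have full rank; let $N_L\in\mathbb C^{n\times(n-k)}$ be a matrix whose columns form a basis of $\ker B_L$; * periodic: $\mathbf u(L)=\mathbf u(0)$. For $\lambda\in\mathbb C$ write $(\mathcal L-\lambda)u=f$ as the first-order system $\mathbf u'=A(x,\lambda)\mathbf u+\vec f$, where $A$ is the companion matrix and $\vec f=(0,\dots,0,f/a_n)^T$. Let $U(x)=U(x,\lambda)$ be the fundamental matrix, $U'=A(x,\lambda)U$, $U(0)=I$, and let $M=U(L)$. Put $$E(\lambda)=\det(B_RMN_L),\qquad P=N_L\,\mathrm{adj}(B_RMN_L)\,B_RM\qquad\text{(separated)},$$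 $$E(\lambda)=\det(M-I),\qquad P=\mathrm{adj}(M-I)\,M\qquad\text{(periodic)},$$ and $$\mathcal G(x,y,\lambda)=\begin{cases}U(x)\,(E(\lambda)I-P)\,U^{-1}(y),& y<x,\\ -U(x)\,P\,U^{-1}(y),& y>x,\end{cases}\qquad G(x,y,\lambda)=\frac{[\mathcal G(x,y,\lambda)]_{1n}}{a_n(y)},$$ $$W(\lambda)=\Big(\int_0^L\!\!\int_0^L|G(x,y,\lambda)|^2\,dy\,dx\Big)^{1/2}.$$ Let $\rho(\mathcal L)$ be the set of $\lambda\in\mathbb C$ for which $\mathcal L-\lambda$ is a bijection from the domain of $\mathcal L$ onto $L^2([0,L];\mathbb C)$ with bounded inverse. Then: 1. For every $\lambda\in\mathbb C$, $\lambda\in\rho(\mathcal L)$ if and only if $E(\lambda)\ne 0$. 2. For every $\lambda\in\rho(\mathcal L)$, $W(\lambda)>0$ and $\displaystyle\|(\mathcal L-\lambda)^{-1}\|\le\frac{W(\lambda)}{|E(\lambda)|}$. 3. For every $\lambda\in\rho(\mathcal L)$, the open disk $\{\mu\in\mathbb C:|\mu-\lambda|<|E(\lambda)/W(\lambda)|\}$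 is contained in $\rho(\mathcal L)$. 4. $W^2$ is real-analytic on $\mathbb C\cong\mathbb R^2$, and $W$ is real-analytic at every $\lambda$ with $W(\lambda)\neq 0$, in particular on $\rho(\mathcal L)$. -/

import Mathlib

open MeasureTheory Set
open scoped Matrix

noncomputable section

/-- A regular linear ordinary differential expression of order `d + 1` on `[0, len]`,
`u ↦ lead * u^(d+1) + ∑_{j ≤ d} coeff j * u^(j)`. -/
structure DiffExpr (d : ℕ) where
  len : ℝ
  len_pos : 0 < len
  coeff : Fin (d + 1) → ℝ → ℂ
  lead : ℝ → ℂ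
  coeff_cont : ∀ j, ContinuousOn (coeff j) (Icc 0 len)
  lead_cont : ContinuousOn lead (Icc 0 len)
  lead_ne : ∀ x ∈ Icc 0 len, lead x ≠ 0

/-- Separated homogeneous boundary conditions `BL u(0) = 0`, `BR u(L) = 0` of full rank, with
`k` conditions on the left and `m = d + 1 - k` on the right, together with a matrix `NL` whose
columns form a basis of the null space of `BL`. -/
structure SeparatedBC (d : ℕ) where
  k : ℕ
  m : ℕ
  count : k + m = d + 1
  BL : Matrix (Fin k) (Fin (d + 1)) ℂ
  BR : Matrix (Fin m) (Fin (d + 1)) ℂ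
  NL : Matrix (Fin (d + 1)) (Fin m) ℂ
  BL_rank : LinearIndependent ℂ BL.row
  BR_rank : LinearIndependent ℂ BR.row
  NL_indep : LinearIndependent ℂ NL.col
  NL_span : ∀ v : Fin (d + 1) → ℂ, v ∈ Submodule.span ℂ (Set.range NL.col) ↔ BL *ᵥ v = 0

/-- The two classes of boundary conditions. -/
inductive BoundaryCondition (d : ℕ) where
  | separated (S : SeparatedBC d)
  | periodic

namespace BoundaryCondition

/-- The boundary condition, for the boundary values `v0 = u(0)` and `v1 = u(L)` of the vector
`(u, u', …, u^(d))`. -/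
def Holds {d : ℕ} : BoundaryCondition d → (Fin (d + 1) → ℂ) → (Fin (d + 1) → ℂ) → Prop
  | separated S, v0, v1 => S.BL *ᵥ v0 = 0 ∧ S.BR *ᵥ v1 = 0
  | periodic, v0, v1 => v1 = v0

/-- The Evans determinant as a function of the monodromy matrix `M`. -/
def evans {d : ℕ} : BoundaryCondition d → Matrix (Fin (d + 1)) (Fin (d + 1)) ℂ → ℂ
  | separated S, M => (S.BR * M * S.NL).det
  | periodic, M => (M - 1).det

/-- The matrix `P` as a function of the monodromy matrix `M`; the inverse, multiplied by the
Evans determinant, is written as an adjugate. -/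
def projMatrix {d : ℕ} : BoundaryCondition d → Matrix (Fin (d + 1)) (Fin (d + 1)) ℂ →
    Matrix (Fin (d + 1)) (Fin (d + 1)) ℂ
  | separated S, M => S.NL * (S.BR * M * S.NL).adjugate * S.BR * M
  | periodic, M => (M - 1).adjugate * M

end BoundaryCondition

/-! ### The fundamental matrix of a linear system -/

/-- `U` is the fundamental matrix of `u' = A(x) u` on `[0, L]`, normalized by `U(0) = I`. -/
def IsFundamentalMatrix {ι : Type*} [Fintype ι] [DecidableEq ι] (A : ℝ → Matrix ι ι ℂ) (L : ℝ)
    (U : ℝ → Matrix ι ι ℂ) : Prop :=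
  U 0 = 1 ∧ ∀ x ∈ Icc 0 L, ∀ i j,
    HasDerivWithinAt (fun t => U t i j) ((A x * U x) i j) (Icc 0 L) x

/-- Global existence for a linear equation with continuous bounded coefficient in a Banach
algebra, by the iterated integral series. -/
theorem exists_linear_solution {R : Type*} [NormedRing R] [NormedAlgebra ℝ R] [CompleteSpace R]
    (A : ℝ → R) (hA : Continuous A) (K : ℝ) (hK : ∀ x, ‖A x‖ ≤ K) :
    ∃ U : ℝ → R, U 0 = 1 ∧ ∀ x, HasDerivAt U (A x * U x) x := by
  have hK0 : 0 ≤ K := (norm_nonneg _).trans (hK 0)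
  obtain ⟨T, hT0, hTs⟩ : ∃ T : ℕ → ℝ → R, (∀ x, T 0 x = 1) ∧
      ∀ k x, T (k + 1) x = ∫ t in (0 : ℝ)..x, A t * T k t :=
    ⟨fun k => Nat.rec (fun _ => 1) (fun _ f x => ∫ t in (0 : ℝ)..x, A t * f t) k,
      fun _ => rfl, fun _ _ => rfl⟩
  have hcont : ∀ k, Continuous (T k) := by
    intro k
    induction k with
    | zero => rw [funext hT0]; exact continuous_const
    | succ k ih =>
      have : Continuous fun t => A t * T k t := hA.mul ih
      rw [funext (hTs k)]
      exact intervalIntegral.continuous_primitive (fun a b => this.intervalIntegrable a b) 0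
  have hder : ∀ k x, HasDerivAt (T (k + 1)) (A x * T k x) x := by
    intro k x
    have : Continuous fun t => A t * T k t := hA.mul (hcont k)
    rw [funext (hTs k)]
    exact intervalIntegral.integral_hasDerivAt_right (this.intervalIntegrable _ _)
      (this.stronglyMeasurableAtFilter _ _) this.continuousAt
  have hbd : ∀ k x, ‖T k x‖ ≤ ‖(1 : R)‖ * ((K * |x|) ^ k / (k.factorial : ℝ)) := by
    intro k
    induction k with
    | zero => intro x; simp [hT0]
    | succ k ih =>
      have key : ∀ y : ℝ, 0 ≤ y → ∀ B : ℝ → R, (∀ t ∈ Ioc 0 y,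
          ‖B t‖ ≤ K * (‖(1 : R)‖ * ((K * t) ^ k / (k.factorial : ℝ)))) →
          ‖∫ t in (0 : ℝ)..y, B t‖ ≤
            ‖(1 : R)‖ * ((K * y) ^ (k + 1) / ((k + 1).factorial : ℝ)) := by
        intro y hy B hB
        have h1 := intervalIntegral.norm_integral_le_of_norm_le (μ := volume) hy
          (f := B) (g := fun t => K * (‖(1 : R)‖ * ((K * t) ^ k / (k.factorial : ℝ))))
          (Filter.Eventually.of_forall fun t ht => hB t ht)
          (Continuous.intervalIntegrable (by fun_prop) _ _)
        refine h1.trans (le_of_eq ?_)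
        have h2 : (fun t : ℝ => K * (‖(1 : R)‖ * ((K * t) ^ k / (k.factorial : ℝ)))) =
            fun t => (K ^ (k + 1) * ‖(1 : R)‖ / (k.factorial : ℝ)) * t ^ k := by
          funext t; rw [mul_pow]; ring
        rw [h2, intervalIntegral.integral_const_mul, integral_pow, Nat.factorial_succ]
        push_cast
        have : (k.factorial : ℝ) ≠ 0 := by exact_mod_cast k.factorial_ne_zero
        have : (k : ℝ) + 1 ≠ 0 := by positivity
        field_simp
        ring
      intro x
      rw [hTs]
      have hpt : ∀ t, ‖A t * T k t‖ ≤ K * (‖(1 : R)‖ * ((K * |t|) ^ k / (k.factorial : ℝ))) :=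
        fun t => (norm_mul_le _ _).trans (mul_le_mul (hK t) (ih t) (norm_nonneg _) hK0)
      rcases le_total 0 x with hx | hx
      · rw [abs_of_nonneg hx]
        refine key x hx _ fun t ht => ?_
        have := hpt t
        rwa [abs_of_pos ht.1] at this
      · rw [abs_of_nonpos hx]
        have hneg : ‖∫ t in (0 : ℝ)..x, A t * T k t‖ =
            ‖∫ t in (0 : ℝ)..(-x), A (-t) * T k (-t)‖ := by
          rw [intervalIntegral.integral_comp_neg (fun t => A t * T k t), neg_neg, neg_zero,
            intervalIntegral.integral_symm, norm_neg]
        rw [hneg]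
        refine key (-x) (by linarith) _ fun t ht => ?_
        have := hpt (-t)
        rwa [abs_neg, abs_of_pos ht.1] at this
  have hsum : ∀ x, Summable fun k => T k x := fun x =>
    Summable.of_norm_bounded ((Real.summable_pow_div_factorial (K * |x|)).mul_left _)
      fun k => hbd k x
  refine ⟨fun x => ∑' k, T k x, ?_, ?_⟩
  · have : ∀ k, k ≠ 0 → T k 0 = 0 := by
      intro k hk
      obtain ⟨j, rfl⟩ := Nat.exists_eq_succ_of_ne_zero hk
      simp [hTs]
    change ∑' k, T k 0 = 1
    rw [tsum_eq_single 0 this, hT0]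
  · intro x
    have hx : x ∈ Metric.ball (0 : ℝ) (|x| + 1) := by simp
    have hu : Summable fun k : ℕ =>
        K * (‖(1 : R)‖ * ((K * (|x| + 1)) ^ k / (k.factorial : ℝ))) :=
      ((Real.summable_pow_div_factorial (K * (|x| + 1))).mul_left _).mul_left _
    have hb : ∀ (k : ℕ) (y : ℝ), y ∈ Metric.ball (0 : ℝ) (|x| + 1) →
        ‖A y * T k y‖ ≤ K * (‖(1 : R)‖ * ((K * (|x| + 1)) ^ k / (k.factorial : ℝ))) := by
      intro k y hy
      have hy' : |y| ≤ |x| + 1 := by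
        have := Metric.mem_ball.1 hy
        rw [Real.dist_eq, sub_zero] at this
        exact this.le
      have h1 : (K * |y|) ^ k ≤ (K * (|x| + 1)) ^ k :=
        pow_le_pow_left₀ (mul_nonneg hK0 (abs_nonneg y)) (mul_le_mul_of_nonneg_left hy' hK0) k
      have h2 : ‖T k y‖ ≤ ‖(1 : R)‖ * ((K * (|x| + 1)) ^ k / (k.factorial : ℝ)) :=
        (hbd k y).trans (mul_le_mul_of_nonneg_left
          (div_le_div_of_nonneg_right h1 (Nat.cast_nonneg _)) (norm_nonneg _))
      exact (norm_mul_le _ _).trans (mul_le_mul (hK y) h2 (norm_nonneg _) hK0)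
    have hmain : HasDerivAt (fun y => ∑' k, T (k + 1) y) (∑' k, A x * T k x) x :=
      hasDerivAt_tsum_of_isPreconnected (g := fun k y => T (k + 1) y)
        (g' := fun k y => A y * T k y) hu
        Metric.isOpen_ball (convex_ball (0 : ℝ) (|x| + 1)).isPreconnected
        (fun k y _ => hder k y) hb hx ((summable_nat_add_iff 1).2 (hsum x)) hx
    have heq : (fun y => ∑' k, T k y) = fun y => 1 + ∑' k, T (k + 1) y := by
      funext y
      rw [(hsum y).tsum_eq_zero_add, hT0]
    change HasDerivAt (fun y => ∑' k, T k y) (A x * ∑' k, T k x) x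
    rw [heq, ← (hsum x).tsum_mul_left]
    exact hmain.const_add 1

section

attribute [local instance] Matrix.linftyOpNormedRing Matrix.linftyOpNormedAlgebra

theorem exists_isFundamentalMatrix {ι : Type*} [Fintype ι] [DecidableEq ι]
    (A : ℝ → Matrix ι ι ℂ) (L : ℝ) (hL : 0 ≤ L)
    (hA : ∀ i j, ContinuousOn (fun x => A x i j) (Icc 0 L)) :
    ∃ U, IsFundamentalMatrix A L U := by
  let B : ℝ → Matrix ι ι ℂ := fun x => A (projIcc 0 L hL x)
  have hAc : ContinuousOn A (Icc 0 L) :=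
    continuousOn_pi.2 fun i => continuousOn_pi.2 fun j => hA i j
  have hB : Continuous B := (continuousOn_iff_continuous_domRestrict.1 hAc).comp continuous_projIcc
  obtain ⟨K, hK⟩ := isCompact_Icc.exists_bound_of_continuousOn hAc
  have : CompleteSpace (Matrix ι ι ℂ) := inferInstance
  obtain ⟨U, hU0, hU⟩ := exists_linear_solution B hB K fun x => hK _ (projIcc 0 L hL x).2
  refine ⟨U, hU0, fun x hx i j => ?_⟩
  have hBx : B x = A x := by simp only [B, projIcc_of_mem hL hx]
  have h1 := hU x
  rw [hBx] at h1
  have h2 := hasDerivAt_pi.1 (hasDerivAt_pi.1 h1 i) j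
  exact h2.hasDerivWithinAt

end

namespace DiffExpr

variable {d : ℕ} (D : DiffExpr d)

/-- The coefficient matrix of `(ℒ - z) u = 0` written as a first-order system for
`(u, u', …, u^(d))`. The equation `(ℒ - z) u = f` becomes `v' = A(x, z) v + F` where the last
coordinate of `F` is `f / lead` and the others vanish. -/
def companion (z : ℂ) (x : ℝ) : Matrix (Fin (d + 1)) (Fin (d + 1)) ℂ := fun i j =>
  if i = Fin.last d then ((if j = 0 then z else 0) - D.coeff j x) / D.lead x
  else if (j : ℕ) = i + 1 then 1 else 0

theorem continuousOn_companion (z : ℂ) (i j : Fin (d + 1)) :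
    ContinuousOn (fun x => D.companion z x i j) (Icc 0 D.len) := by
  unfold companion
  split_ifs
  · exact (continuousOn_const.sub (D.coeff_cont j)).div D.lead_cont D.lead_ne
  · exact (continuousOn_const.sub (D.coeff_cont j)).div D.lead_cont D.lead_ne
  · exact continuousOn_const
  · exact continuousOn_const

/-- The fundamental matrix `U(x, z)` of the first-order system, with `U(0, z) = I`. -/
def fundamental (z : ℂ) : ℝ → Matrix (Fin (d + 1)) (Fin (d + 1)) ℂ :=
  (exists_isFundamentalMatrix (D.companion z) D.len D.len_pos.le
    (D.continuousOn_companion z)).choose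

theorem isFundamentalMatrix_fundamental (z : ℂ) :
    IsFundamentalMatrix (D.companion z) D.len (D.fundamental z) :=
  (exists_isFundamentalMatrix (D.companion z) D.len D.len_pos.le
    (D.continuousOn_companion z)).choose_spec

/-- The monodromy matrix `M(z) = U(L, z)`. -/
def monodromy (z : ℂ) : Matrix (Fin (d + 1)) (Fin (d + 1)) ℂ := D.fundamental z D.len

/-- The Evans function `E(z)`. -/
def evans (bc : BoundaryCondition d) (z : ℂ) : ℂ := bc.evans (D.monodromy z)

/-- The matrix Green's kernel `𝒢(x, y, z)` (multiplied by the Evans function). -/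
def greenMatrix (bc : BoundaryCondition d) (z : ℂ) (x y : ℝ) :
    Matrix (Fin (d + 1)) (Fin (d + 1)) ℂ :=
  if y < x then
    D.fundamental z x *
      (D.evans bc z • (1 : Matrix (Fin (d + 1)) (Fin (d + 1)) ℂ) - bc.projMatrix (D.monodromy z)) *
      (D.fundamental z y)⁻¹
  else -(D.fundamental z x * bc.projMatrix (D.monodromy z) * (D.fundamental z y)⁻¹)

/-- The scalar kernel `G`: the entry of `𝒢` in the first row and last column. The factor
`1 / lead` comes from the forcing term of the system; it is `1` for a monic operator. -/
def green (bc : BoundaryCondition d) (z : ℂ) (x y : ℝ) : ℂ :=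
  D.greenMatrix bc z x y 0 (Fin.last d) / D.lead y

/-- The weighting function `W(z)`: the `L²([0, L]²)` norm of `G`. -/
def weight (bc : BoundaryCondition d) (z : ℂ) : ℝ :=
  Real.sqrt (∫ x in (0 : ℝ)..D.len, ∫ y in (0 : ℝ)..D.len, ‖D.green bc z x y‖ ^ 2)

/-! ### The operator on `L²([0, L]; ℂ)` -/

/-- Lebesgue measure on `[0, L]`. -/
abbrev vol : Measure ℝ := volume.restrict (Icc 0 D.len)

/-- The Hilbert space `L²([0, L]; ℂ)`. -/
abbrev H : Type := Lp ℂ 2 D.vol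

/-- `v = (u, u', …, u^(d))` on `[0, L]`, with `u^(d)` absolutely continuous and
`g = u^(d+1) ∈ L²`; that is, `u = v 0` belongs to the Sobolev space `H^(d+1)(0, L)`. -/
structure IsJet (v : Fin (d + 1) → ℝ → ℂ) (g : ℝ → ℂ) : Prop where
  memLp : MemLp g 2 D.vol
  step : ∀ i : Fin d, ∀ x ∈ Icc 0 D.len,
    v i.castSucc x = v i.castSucc 0 + ∫ t in (0 : ℝ)..x, v i.succ t
  top : ∀ x ∈ Icc 0 D.len, v (Fin.last d) x = v (Fin.last d) 0 + ∫ t in (0 : ℝ)..x, g t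

variable {D}

theorem IsJet.integrableOn {v : Fin (d + 1) → ℝ → ℂ} {g : ℝ → ℂ} (h : D.IsJet v g) :
    IntegrableOn g (Icc 0 D.len) := h.memLp.integrable (by norm_num)

theorem continuousOn_of_primitive {f g : ℝ → ℂ} {L : ℝ} (hL : 0 ≤ L)
    (hg : IntegrableOn g (Icc 0 L))
    (h : ∀ x ∈ Icc 0 L, f x = f 0 + ∫ t in (0 : ℝ)..x, g t) : ContinuousOn f (Icc 0 L) := by
  have h1 : ContinuousOn (fun x => f 0 + ∫ t in (0 : ℝ)..x, g t) (Icc 0 L) := by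
    have := intervalIntegral.continuousOn_primitive_interval (a := 0) (b := L) (μ := volume)
      (f := g) (by rwa [uIcc_of_le hL])
    rw [uIcc_of_le hL] at this
    exact continuousOn_const.add this
  exact h1.congr h

theorem IsJet.continuousOn {v : Fin (d + 1) → ℝ → ℂ} {g : ℝ → ℂ} (h : D.IsJet v g)
    (i : Fin (d + 1)) : ContinuousOn (v i) (Icc 0 D.len) := by
  induction i using Fin.reverseInduction with
  | last => exact continuousOn_of_primitive D.len_pos.le h.integrableOn h.top
  | cast i ih => exact continuousOn_of_primitive D.len_pos.le ih.integrableOn_Icc (h.step i)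

theorem intervalIntegrable_of_Icc {f : ℝ → ℂ} {L x : ℝ} (hf : IntegrableOn f (Icc 0 L))
    (hx : x ∈ Icc 0 L) : IntervalIntegrable f volume 0 x :=
  (intervalIntegrable_iff_integrableOn_Icc_of_le hx.1).2
    (hf.mono_set (Icc_subset_Icc_right hx.2))

theorem IsJet.add {v v' : Fin (d + 1) → ℝ → ℂ} {g g' : ℝ → ℂ} (h : D.IsJet v g)
    (h' : D.IsJet v' g') : D.IsJet (fun i x => v i x + v' i x) (fun x => g x + g' x) where
  memLp := h.memLp.add h'.memLp
  step i x hx := by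
    rw [intervalIntegral.integral_add
      (intervalIntegrable_of_Icc (h.continuousOn _).integrableOn_Icc hx)
      (intervalIntegrable_of_Icc (h'.continuousOn _).integrableOn_Icc hx), h.step i x hx,
      h'.step i x hx]
    ring
  top x hx := by
    rw [intervalIntegral.integral_add (intervalIntegrable_of_Icc h.integrableOn hx)
      (intervalIntegrable_of_Icc h'.integrableOn hx), h.top x hx, h'.top x hx]
    ring

theorem IsJet.smul {v : Fin (d + 1) → ℝ → ℂ} {g : ℝ → ℂ} (c : ℂ) (h : D.IsJet v g) :
    D.IsJet (fun i x => c * v i x) (fun x => c * g x) where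
  memLp := h.memLp.const_mul c
  step i x hx := by
    rw [intervalIntegral.integral_const_mul, h.step i x hx]
    ring
  top x hx := by
    rw [intervalIntegral.integral_const_mul, h.top x hx]
    ring

variable (D)

/-- The graph of `ℒ` on `L²([0, L]; ℂ)`: the pairs `(u, ℒ u)` where `u ∈ H^(d+1)(0, L)` satisfies
the boundary condition. -/
def graph (bc : BoundaryCondition d) : Submodule ℂ (D.H × D.H) where
  carrier := {p | ∃ v g, D.IsJet v g ∧ bc.Holds (fun i => v i 0) (fun i => v i D.len) ∧
    (p.1 : ℝ → ℂ) =ᵐ[D.vol] v 0 ∧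
    (p.2 : ℝ → ℂ) =ᵐ[D.vol] fun x => D.lead x * g x + ∑ j, D.coeff j x * v j x}
  add_mem' := by
    rintro ⟨u, f⟩ ⟨u', f'⟩ ⟨v, g, hj, hb, h1, h2⟩ ⟨v', g', hj', hb', h1', h2'⟩
    refine ⟨_, _, hj.add hj', ?_, ?_, ?_⟩
    · cases bc with
      | separated S =>
        constructor
        · change S.BL *ᵥ ((fun i => v i 0) + fun i => v' i 0) = 0
          rw [Matrix.mulVec_add, hb.1, hb'.1, add_zero]
        · change S.BR *ᵥ ((fun i => v i D.len) + fun i => v' i D.len) = 0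
          rw [Matrix.mulVec_add, hb.2, hb'.2, add_zero]
      | periodic =>
        funext i
        exact congrArg₂ (· + ·) (congrFun hb i) (congrFun hb' i)
    · filter_upwards [Lp.coeFn_add u u', h1, h1'] with x hx hx1 hx2
      change (u + u' : D.H) x = _
      rw [hx, Pi.add_apply]
      exact congrArg₂ (· + ·) hx1 hx2
    · filter_upwards [Lp.coeFn_add f f', h2, h2'] with x hx hx1 hx2
      change (f + f' : D.H) x = _
      rw [hx, Pi.add_apply]
      refine (congrArg₂ (· + ·) hx1 hx2).trans ?_
      simp only [mul_add, Finset.sum_add_distrib]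
      ring
  zero_mem' := by
    refine ⟨fun _ _ => 0, fun _ => 0, ⟨MemLp.zero', by simp, by simp⟩, ?_, ?_, ?_⟩
    · cases bc with
      | separated S => exact ⟨Matrix.mulVec_zero _, Matrix.mulVec_zero _⟩
      | periodic => rfl
    · exact Lp.coeFn_zero ..
    · simp only [mul_zero, Finset.sum_const_zero, add_zero]
      exact Lp.coeFn_zero ..
  smul_mem' := by
    rintro c ⟨u, f⟩ ⟨v, g, hj, hb, h1, h2⟩
    refine ⟨_, _, hj.smul c, ?_, ?_, ?_⟩
    · cases bc with
      | separated S =>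
        constructor
        · change S.BL *ᵥ (c • fun i => v i 0) = 0
          rw [Matrix.mulVec_smul, hb.1, smul_zero]
        · change S.BR *ᵥ (c • fun i => v i D.len) = 0
          rw [Matrix.mulVec_smul, hb.2, smul_zero]
      | periodic =>
        funext i
        exact congrArg (c * ·) (congrFun hb i)
    · filter_upwards [Lp.coeFn_smul c u, h1] with x hx hx1
      change (c • u : D.H) x = _
      rw [hx, Pi.smul_apply, smul_eq_mul]
      exact congrArg (c * ·) hx1
    · filter_upwards [Lp.coeFn_smul c f, h2] with x hx hx1
      change (c • f : D.H) x = _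
      rw [hx, Pi.smul_apply, smul_eq_mul]
      refine (congrArg (c * ·) hx1).trans ?_
      simp only [mul_add, Finset.mul_sum]
      refine congrArg₂ (· + ·) (by ring) (Finset.sum_congr rfl fun j _ => by ring)

/-- The differential operator `ℒ` with the boundary condition `bc`, as an unbounded operator on
`L²([0, L]; ℂ)`. -/
def operator (bc : BoundaryCondition d) : D.H →ₗ.[ℂ] D.H := (D.graph bc).toLinearPMap

variable {D}

theorem ae_zero_of_primitive_zero {g : ℝ → ℂ} {L : ℝ} (hL : 0 < L)
    (hg : IntegrableOn g (Icc 0 L)) (h : ∀ x ∈ Icc 0 L, ∫ t in (0 : ℝ)..x, g t = 0) :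
    g =ᵐ[volume.restrict (Icc 0 L)] 0 := by
  have h1 := (intervalIntegrable_of_Icc hg ⟨hL.le, le_rfl⟩).ae_hasDerivAt_integral
  rw [uIcc_of_le hL.le] at h1
  refine (ae_restrict_iff' measurableSet_Icc).2 (h1.mono fun x hx hxL => ?_)
  have h2 := (hx hxL 0 ⟨le_rfl, hL.le⟩).hasDerivWithinAt (s := Icc 0 L)
  have h3 : HasDerivWithinAt (fun y => ∫ t in (0 : ℝ)..y, g t) 0 (Icc 0 L) x :=
    (hasDerivWithinAt_const x (Icc 0 L) (0 : ℂ)).congr h (h x hxL)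
  exact (uniqueDiffOn_Icc hL x hxL).eq_deriv _ h2 h3

/-- The graph is single-valued, so that `operator` has it as its graph. -/
theorem graph_single_valued (bc : BoundaryCondition d) (p : D.H × D.H) (hp : p ∈ D.graph bc)
    (h0 : p.1 = 0) : p.2 = 0 := by
  obtain ⟨v, g, hj, -, h1, h2⟩ := hp
  have hzero : ∀ i, ∀ x ∈ Icc 0 D.len, v i x = 0 := by
    have up : ∀ i, (v i =ᵐ[D.vol] 0) → ∀ x ∈ Icc 0 D.len, v i x = 0 := by
      intro i hi
      exact Measure.eqOn_Icc_of_ae_eq volume D.len_pos.ne hi (hj.continuousOn i)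
        continuousOn_const
    intro i
    induction i using Fin.induction with
    | zero =>
      refine up 0 (h1.symm.trans ?_)
      rw [h0]
      exact Lp.coeFn_zero ..
    | succ i ih =>
      refine up _ (ae_zero_of_primitive_zero D.len_pos
        (hj.continuousOn _).integrableOn_Icc fun x hx => ?_)
      have := hj.step i x hx
      rwa [ih x hx, ih 0 ⟨le_rfl, D.len_pos.le⟩, zero_add, eq_comm] at this
  have hg : g =ᵐ[D.vol] 0 := by
    refine ae_zero_of_primitive_zero D.len_pos hj.integrableOn fun x hx => ?_
    have := hj.top x hx
    rwa [hzero _ x hx, hzero _ 0 ⟨le_rfl, D.len_pos.le⟩, zero_add, eq_comm] at this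
  refine Lp.ext (h2.trans ?_)
  filter_upwards [hg, ae_restrict_mem measurableSet_Icc, Lp.coeFn_zero ℂ 2 D.vol]
    with x hx hx' hx0
  rw [hx, hx0]
  simp [hzero _ x hx']

theorem operator_graph (bc : BoundaryCondition d) : (D.operator bc).graph = D.graph bc :=
  Submodule.toLinearPMap_graph_eq _ (graph_single_valued bc)

end DiffExpr

/-! ### Resolvents of unbounded operators -/

/-- The bounded operator `R` is `(T - z)⁻¹`. -/
def IsResolventAt {X : Type*} [NormedAddCommGroup X] [NormedSpace ℂ X] (T : X →ₗ.[ℂ] X) (z : ℂ)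
    (R : X →L[ℂ] X) : Prop :=
  (∀ f : X, ∃ h : R f ∈ T.domain, T ⟨R f, h⟩ - z • R f = f) ∧
    ∀ u : T.domain, R (T u - z • (u : X)) = u

/-- The resolvent set of an unbounded operator. -/
def unboundedResolventSet {X : Type*} [NormedAddCommGroup X] [NormedSpace ℂ X]
    (T : X →ₗ.[ℂ] X) : Set ℂ :=
  {z | ∃ R : X →L[ℂ] X, IsResolventAt T z R}

end

/-!
The first-order system `v' = A v + (0, …, 0, F / lead)` is solved by Duhamel's formula
`v(x) = U(x) (c + ∫_0^x U⁻¹ (0, …, 0, F / lead))`, where the inverse of the fundamental matrix `U`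
comes from the fundamental matrix of the adjoint system. As `F` is only in `L²`, this uses the
product rule for absolutely continuous functions (`mul_primitive`). A weak solution of the
homogeneous equation is a classical one, hence equal to `U(x) v(0)`
(`IsJet.eq_fundamental_mulVec`).

If `E(z) = 0`, some nonzero `c` satisfies the boundary condition together with `M c`
(`BoundaryCondition.evans_eq_zero_iff`), and `U c` gives an eigenvector. If `E(z) ≠ 0`, there is no
such `c`, so `ℒ - z` is injective; and the initial vector `c = -P H / E`, with `H` the value of the
Duhamel integral at the right end point, makes the boundary condition hold
(`BoundaryCondition.holds_projMatrix`). The resulting solution is the integral of `F` against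
`G / E` (`DiffExpr.integral_green_mul`), so the resolvent is a Hilbert–Schmidt operator, with norm
at most `W / |E|`. Since the resolvent is not zero, neither is `W`, and the Neumann series gives the
disk contained in the resolvent set.

For analyticity, `U(·, w)` is considered as an element of the Banach algebra of continuous
matrix-valued functions. Near `z` the quotient `Y = U(·, z)⁻¹ U(·, w)` solves
`(1 - (w - z) K) Y = 1` with a fixed Volterra operator `K`, hence is holomorphic in `w`
(`differentiable_solution`). So the Green's kernel on each side of the diagonal is a holomorphic
function of the parameter with values in the continuous functions on the square, and `W²` is
obtained from these by a bounded real bilinear form (`DiffExpr.weight_sq_eq`).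
-/

/-! ### Absolutely continuous functions -/

/-- A complex-valued primitive is absolutely continuous, by comparison with the primitive of the
norm of the integrand. -/
theorem absolutelyContinuousOnInterval_primitive {f : ℝ → ℂ} {L : ℝ} (hL : 0 ≤ L)
    (hf : IntegrableOn f (Icc 0 L)) :
    AbsolutelyContinuousOnInterval (fun x => ∫ t in (0 : ℝ)..x, f t) 0 L := by
  have hint : ∀ x ∈ Icc 0 L, IntervalIntegrable f volume 0 x := fun x hx =>
    DiffExpr.intervalIntegrable_of_Icc hf hx
  have hac := (hint L ⟨hL, le_rfl⟩).norm.absolutelyContinuousOnInterval_intervalIntegral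
    (c := 0) left_mem_uIcc
  rw [absolutelyContinuousOnInterval_iff] at hac ⊢
  intro ε hε
  obtain ⟨δ, hδ, h⟩ := hac ε hε
  refine ⟨δ, hδ, fun E hE hlen => (Finset.sum_le_sum fun i hi => ?_).trans_lt (h E hE hlen)⟩
  have h1 := (hE.1 i hi).1
  have h2 := (hE.1 i hi).2
  rw [uIcc_of_le hL] at h1 h2
  rw [dist_eq_norm, dist_eq_norm, intervalIntegral.integral_interval_sub_left (hint _ h1)
    (hint _ h2), intervalIntegral.integral_interval_sub_left (hint _ h1).norm (hint _ h2).norm]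
  exact intervalIntegral.norm_integral_le_abs_integral_norm

/-- The product rule for primitives of integrable functions. -/
theorem mul_primitive {f g f' g' : ℝ → ℂ} {L : ℝ} (hL : 0 ≤ L)
    (hf' : IntegrableOn f' (Icc 0 L)) (hg' : IntegrableOn g' (Icc 0 L))
    (hf : ∀ x ∈ Icc 0 L, f x = f 0 + ∫ t in (0 : ℝ)..x, f' t)
    (hg : ∀ x ∈ Icc 0 L, g x = g 0 + ∫ t in (0 : ℝ)..x, g' t) :
    IntegrableOn (fun t => f' t * g t + f t * g' t) (Icc 0 L) ∧
    ∀ x ∈ Icc 0 L, f x * g x = f 0 * g 0 + ∫ t in (0 : ℝ)..x, (f' t * g t + f t * g' t) := by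
  have hfc := DiffExpr.continuousOn_of_primitive hL hf' hf
  have hgc := DiffExpr.continuousOn_of_primitive hL hg' hg
  have hk : IntegrableOn (fun t => f' t * g t + f t * g' t) (Icc 0 L) :=
    (hf'.mul_continuousOn hgc isCompact_Icc).add (hg'.continuousOn_mul hfc isCompact_Icc)
  refine ⟨hk, ?_⟩
  set F : ℝ → ℂ := fun x => ∫ t in (0 : ℝ)..x, f' t
  set G : ℝ → ℂ := fun x => ∫ t in (0 : ℝ)..x, g' t
  set K : ℝ → ℂ := fun x => ∫ t in (0 : ℝ)..x, (f' t * g t + f t * g' t)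
  have aF : AbsolutelyContinuousOnInterval F 0 L := absolutelyContinuousOnInterval_primitive hL hf'
  have aG : AbsolutelyContinuousOnInterval G 0 L := absolutelyContinuousOnInterval_primitive hL hg'
  have aK : AbsolutelyContinuousOnInterval K 0 L := absolutelyContinuousOnInterval_primitive hL hk
  have ae_der : ∀ {q : ℝ → ℂ}, IntegrableOn q (Icc 0 L) → ∀ᵐ x, x ∈ uIcc 0 L →
      HasDerivAt (fun y => ∫ t in (0 : ℝ)..y, q t) (q x) x := fun hq =>
    ((DiffExpr.intervalIntegrable_of_Icc hq ⟨hL, le_rfl⟩).ae_hasDerivAt_integral).mono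
      fun x hx hxL => hx hxL 0 left_mem_uIcc
  -- The difference of the two sides, expanded at `f = f 0 + F` and `g = g 0 + G`, is absolutely
  -- continuous and has derivative zero almost everywhere.
  have aall := (((aF.smul aG).add (aF.const_smul (g 0))).add (aG.const_smul (f 0))).sub aK
  obtain ⟨C, hC⟩ := aall.const_of_ae_hasDerivAt_zero (by
    filter_upwards [ae_der hf', ae_der hg', ae_der hk] with x h1 h2 h3 hx
    have hx' := hx
    rw [uIcc_of_le hL] at hx'
    have := ((((h1 hx).mul (h2 hx)).add ((h1 hx).const_mul (g 0))).add
      ((h2 hx).const_mul (f 0))).sub (h3 hx)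
    refine this.congr_deriv ?_
    have e1 := hf x hx'
    have e2 := hg x hx'
    rw [e1, e2]
    ring)
  have h0 := hC 0 left_mem_uIcc
  intro x hx
  have hx1 := hC x (by rwa [uIcc_of_le hL])
  simp only [Pi.sub_apply, Pi.add_apply, Pi.mul_apply, smul_eq_mul] at h0 hx1
  have z1 : F 0 = 0 := intervalIntegral.integral_same
  have z2 : G 0 = 0 := intervalIntegral.integral_same
  have z3 : K 0 = 0 := intervalIntegral.integral_same
  rw [z1, z2, z3] at h0
  have e1 : f x = f 0 + F x := hf x hx
  have e2 : g x = g 0 + G x := hg x hx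
  change f x * g x = f 0 * g 0 + K x
  rw [e1, e2]
  linear_combination hx1 - h0

/-- A function with vanishing derivative on a compact interval is constant. -/
theorem eq_of_hasDerivWithinAt_zero {E : Type*} [NormedAddCommGroup E] [NormedSpace ℝ E]
    {f : ℝ → E} {L : ℝ} (hf : ∀ x ∈ Icc 0 L, HasDerivWithinAt f 0 (Icc 0 L) x) :
    ∀ x ∈ Icc 0 L, f x = f 0 :=
  constant_of_has_deriv_right_zero (fun x hx => (hf x hx).continuousWithinAt) fun x hx =>
    (hf x ⟨hx.1, hx.2.le⟩).mono_of_mem_nhdsWithin (Icc_mem_nhdsGE_of_mem hx)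

/-- The fundamental theorem of calculus for a continuously differentiable function. -/
theorem eq_add_integral_of_hasDerivWithinAt {E : Type*} [NormedAddCommGroup E] [NormedSpace ℝ E]
    [CompleteSpace E] {f f' : ℝ → E} {L : ℝ}
    (hf : ∀ x ∈ Icc 0 L, HasDerivWithinAt f (f' x) (Icc 0 L) x)
    (hf' : ContinuousOn f' (Icc 0 L)) :
    ∀ x ∈ Icc 0 L, f x = f 0 + ∫ t in (0 : ℝ)..x, f' t := by
  intro x hx
  have hsub : Icc 0 x ⊆ Icc 0 L := Icc_subset_Icc_right hx.2
  have := intervalIntegral.integral_eq_sub_of_hasDeriv_right_of_le hx.1 (f := f) (f' := f')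
    (fun y hy => ((hf y (hsub hy)).continuousWithinAt).mono hsub)
    (fun y hy => ((hf y (hsub ⟨hy.1.le, hy.2.le⟩)).mono_of_mem_nhdsWithin
      (Icc_mem_nhdsGE_of_mem ⟨hy.1.le, hy.2.trans_le hx.2⟩)).mono Ioi_subset_Ici_self)
    ((intervalIntegrable_iff_integrableOn_Icc_of_le hx.1).2
      ((hf'.mono hsub).integrableOn_Icc))
  rw [this]
  abel

/-- A primitive of a continuous function is differentiable. -/
theorem hasDerivWithinAt_of_primitive {f f' : ℝ → ℂ} {L : ℝ} (hf' : ContinuousOn f' (Icc 0 L))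
    (hf : ∀ x ∈ Icc 0 L, f x = f 0 + ∫ t in (0 : ℝ)..x, f' t) :
    ∀ x ∈ Icc 0 L, HasDerivWithinAt f (f' x) (Icc 0 L) x := by
  intro x hx
  have hL : 0 ≤ L := hx.1.trans hx.2
  have hc : Continuous fun t => f' (projIcc 0 L hL t) :=
    hf'.domRestrict.comp continuous_projIcc
  have h1 := (intervalIntegral.integral_hasDerivAt_right (hc.intervalIntegrable 0 x)
    (hc.stronglyMeasurableAtFilter _ _) hc.continuousAt).const_add (f 0)
  have h2 := h1.hasDerivWithinAt (s := Icc 0 L)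
  rw [projIcc_of_mem hL hx] at h2
  refine h2.congr_of_mem (fun y hy => ?_) hx
  rw [hf y hy]
  congr 1
  refine intervalIntegral.integral_congr fun t ht => ?_
  rw [uIcc_of_le hy.1] at ht
  simp only [projIcc_of_mem hL ⟨ht.1, ht.2.trans hy.2⟩]

/-! ### Fundamental matrices -/

section FundamentalMatrix

attribute [local instance] Matrix.linftyOpNormedRing Matrix.linftyOpNormedAlgebra

variable {ι : Type*} [Fintype ι] [DecidableEq ι] {A U : ℝ → Matrix ι ι ℂ} {L : ℝ}

omit [DecidableEq ι] in
theorem hasDerivWithinAt_matrix {V : ℝ → Matrix ι ι ℂ} {V' : Matrix ι ι ℂ} {s : Set ℝ} {x : ℝ} :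
    HasDerivWithinAt V V' s x ↔ ∀ i j, HasDerivWithinAt (fun t => V t i j) (V' i j) s x := by
  constructor
  · intro h i j
    exact hasDerivWithinAt_pi.1 (hasDerivWithinAt_pi.1 h i) j
  · intro h
    exact hasDerivWithinAt_pi.2 fun i => hasDerivWithinAt_pi.2 fun j => h i j

theorem IsFundamentalMatrix.hasDerivWithinAt (hU : IsFundamentalMatrix A L U) {x : ℝ}
    (hx : x ∈ Icc 0 L) : HasDerivWithinAt U (A x * U x) (Icc 0 L) x :=
  hasDerivWithinAt_matrix.2 (hU.2 x hx)

/-- The inverse of a fundamental matrix for `A` is the transpose of the fundamental matrix of the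
adjoint system, whose coefficient is `-Aᵀ`. -/
theorem IsFundamentalMatrix.exists_leftInverse (hU : IsFundamentalMatrix A L U) (hL : 0 ≤ L)
    (hA : ∀ i j, ContinuousOn (fun x => A x i j) (Icc 0 L)) :
    ∃ V : ℝ → Matrix ι ι ℂ, ∀ x ∈ Icc 0 L, V x * U x = 1 ∧
      HasDerivWithinAt V (-(V x * A x)) (Icc 0 L) x := by
  obtain ⟨W, hW0, hW⟩ := exists_isFundamentalMatrix (fun x => -(A x)ᵀ) L hL
    fun i j => (hA j i).neg
  have hV : ∀ x ∈ Icc 0 L, HasDerivWithinAt (fun t => (W t)ᵀ) (-((W x)ᵀ * A x)) (Icc 0 L) x := by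
    intro x hx
    refine hasDerivWithinAt_matrix.2 fun i j => ?_
    have h := hW x hx j i
    have e : (-(A x)ᵀ * W x) j i = (-((W x)ᵀ * A x)) i j := by
      rw [← Matrix.transpose_apply (-(A x)ᵀ * W x), Matrix.transpose_mul, Matrix.transpose_neg,
        Matrix.transpose_transpose, Matrix.mul_neg]
    rw [e] at h
    exact h
  refine ⟨fun t => (W t)ᵀ, fun x hx => ⟨?_, hV x hx⟩⟩
  -- `Wᵀ U` has derivative `-Wᵀ A U + Wᵀ A U = 0`.
  have hz : ∀ x ∈ Icc 0 L, HasDerivWithinAt (fun t => (W t)ᵀ * U t) 0 (Icc 0 L) x := by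
    intro x hx
    refine ((hV x hx).mul (hU.hasDerivWithinAt hx)).congr_deriv ?_
    rw [Matrix.neg_mul, Matrix.mul_assoc]
    exact neg_add_cancel _
  have := eq_of_hasDerivWithinAt_zero hz x hx
  change (W x)ᵀ * U x = 1
  rw [this, hU.1, hW0, Matrix.transpose_one, Matrix.mul_one]

variable (hU : IsFundamentalMatrix A L U) (hL : 0 ≤ L)
  (hA : ∀ i j, ContinuousOn (fun x => A x i j) (Icc 0 L))

include hU hL hA

theorem IsFundamentalMatrix.inv_mul {x : ℝ} (hx : x ∈ Icc 0 L) : (U x)⁻¹ * U x = 1 := by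
  obtain ⟨V, hV⟩ := hU.exists_leftInverse hL hA
  rw [Matrix.inv_eq_left_inv (hV x hx).1]
  exact (hV x hx).1

theorem IsFundamentalMatrix.mul_inv {x : ℝ} (hx : x ∈ Icc 0 L) : U x * (U x)⁻¹ = 1 :=
  mul_eq_one_comm.1 (hU.inv_mul hL hA hx)

theorem IsFundamentalMatrix.hasDerivWithinAt_inv {x : ℝ} (hx : x ∈ Icc 0 L) :
    HasDerivWithinAt (fun t => (U t)⁻¹) (-((U x)⁻¹ * A x)) (Icc 0 L) x := by
  obtain ⟨V, hV⟩ := hU.exists_leftInverse hL hA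
  have e : ∀ y ∈ Icc 0 L, (U y)⁻¹ = V y := fun y hy => Matrix.inv_eq_left_inv (hV y hy).1
  rw [e x hx]
  exact (hV x hx).2.congr_of_mem e hx

/-- Solutions of the homogeneous system are determined by their initial values. -/
theorem IsFundamentalMatrix.eq_mulVec {v : ι → ℝ → ℂ}
    (hv : ∀ x ∈ Icc 0 L, ∀ i, HasDerivWithinAt (v i) ((A x *ᵥ fun j => v j x) i) (Icc 0 L) x) :
    ∀ x ∈ Icc 0 L, (fun i => v i x) = U x *ᵥ fun i => v i 0 := by
  have hz : ∀ y ∈ Icc 0 L,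
      HasDerivWithinAt (fun t => (U t)⁻¹ *ᵥ fun j => v j t) 0 (Icc 0 L) y := by
    intro y hy
    refine hasDerivWithinAt_pi.2 fun i => ?_
    have hW := hasDerivWithinAt_matrix.1 (hU.hasDerivWithinAt_inv hL hA hy) i
    have := HasDerivWithinAt.fun_sum (u := Finset.univ) fun j _ => (hW j).mul (hv y hy j)
    refine this.congr_deriv ?_
    rw [Finset.sum_add_distrib]
    change ((-((U y)⁻¹ * A y)) *ᵥ fun j => v j y) i + ((U y)⁻¹ *ᵥ (A y *ᵥ fun j => v j y)) i = 0
    rw [Matrix.mulVec_mulVec, Matrix.neg_mulVec, Pi.neg_apply, neg_add_cancel]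
  intro x hx
  have h := eq_of_hasDerivWithinAt_zero hz x hx
  rw [hU.1, inv_one, Matrix.one_mulVec] at h
  rw [← h, Matrix.mulVec_mulVec, hU.mul_inv hL hA hx, Matrix.one_mulVec]

omit hL hA in
theorem IsFundamentalMatrix.continuousOn (i j : ι) :
    ContinuousOn (fun x => U x i j) (Icc 0 L) :=
  fun x hx => (hU.2 x hx i j).continuousWithinAt

theorem IsFundamentalMatrix.continuousOn_inv (i j : ι) :
    ContinuousOn (fun x => (U x)⁻¹ i j) (Icc 0 L) :=
  fun _ hx => (hasDerivWithinAt_matrix.1 (hU.hasDerivWithinAt_inv hL hA hx) i j).continuousWithinAt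

end FundamentalMatrix

/-! ### Boundary matrices -/

namespace BoundaryCondition

variable {d : ℕ}

/-- The Evans determinant vanishes exactly when some nonzero initial vector satisfies the boundary
condition together with its image under the monodromy matrix. -/
theorem evans_eq_zero_iff (bc : BoundaryCondition d)
    (M : Matrix (Fin (d + 1)) (Fin (d + 1)) ℂ) :
    bc.evans M = 0 ↔ ∃ v, v ≠ 0 ∧ bc.Holds v (M *ᵥ v) := by
  cases bc with
  | periodic =>
    change (M - 1).det = 0 ↔ ∃ v, v ≠ 0 ∧ M *ᵥ v = v
    rw [← Matrix.exists_mulVec_eq_zero_iff]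
    simp only [Matrix.sub_mulVec, Matrix.one_mulVec, sub_eq_zero]
  | separated S =>
    change (S.BR * M * S.NL).det = 0 ↔ ∃ v, v ≠ 0 ∧ S.BL *ᵥ v = 0 ∧ S.BR *ᵥ (M *ᵥ v) = 0
    have hinj : ∀ w, S.NL *ᵥ w = 0 → w = 0 := fun w hw =>
      Matrix.mulVec_injective_iff.2 S.NL_indep (hw.trans (Matrix.mulVec_zero _).symm)
    have hker : ∀ v, S.BL *ᵥ v = 0 ↔ ∃ w, S.NL *ᵥ w = v := fun v => by
      rw [← S.NL_span]
      change v ∈ Submodule.span ℂ (Set.range S.NLᵀ) ↔ _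
      rw [← Matrix.col, ← Matrix.range_mulVecLin]
      rfl
    rw [← Matrix.exists_mulVec_eq_zero_iff]
    constructor
    · rintro ⟨w, hw, h⟩
      refine ⟨S.NL *ᵥ w, fun h0 => hw (hinj w h0), (hker _).2 ⟨w, rfl⟩, ?_⟩
      rwa [Matrix.mulVec_mulVec, Matrix.mulVec_mulVec]
    · rintro ⟨v, hv, h1, h2⟩
      obtain ⟨w, rfl⟩ := (hker v).1 h1
      refine ⟨w, fun h0 => hv (by rw [h0, Matrix.mulVec_zero]), ?_⟩
      rwa [Matrix.mulVec_mulVec, Matrix.mulVec_mulVec] at h2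

/-- The initial vector `-P H` makes the boundary condition hold for the inhomogeneous system whose
solution arrives at `M (u(0) + E H)`. -/
theorem holds_projMatrix (bc : BoundaryCondition d)
    (M : Matrix (Fin (d + 1)) (Fin (d + 1)) ℂ) (H : Fin (d + 1) → ℂ) :
    bc.Holds (-(bc.projMatrix M *ᵥ H)) (M *ᵥ (-(bc.projMatrix M *ᵥ H) + bc.evans M • H)) := by
  cases bc with
  | periodic =>
    change M *ᵥ (-(((M - 1).adjugate * M) *ᵥ H) + (M - 1).det • H) = -(((M - 1).adjugate * M) *ᵥ H)
    have h : (M - 1) *ᵥ (((M - 1).adjugate * M) *ᵥ H) = (M - 1).det • M *ᵥ H := by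
      rw [Matrix.mulVec_mulVec, ← Matrix.mul_assoc, Matrix.mul_adjugate, Matrix.smul_mul,
        Matrix.one_mul, Matrix.smul_mulVec]
    rw [Matrix.sub_mulVec, Matrix.one_mulVec] at h
    rw [Matrix.mulVec_add, Matrix.mulVec_neg, Matrix.mulVec_smul, ← h]
    abel
  | separated S =>
    set Q := S.BR * M * S.NL with hQ
    change S.BL *ᵥ (-((S.NL * Q.adjugate * S.BR * M) *ᵥ H)) = 0 ∧
      S.BR *ᵥ (M *ᵥ (-((S.NL * Q.adjugate * S.BR * M) *ᵥ H) + Q.det • H)) = 0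
    constructor
    · rw [Matrix.mulVec_neg, neg_eq_zero, ← S.NL_span]
      change _ ∈ Submodule.span ℂ (Set.range S.NLᵀ)
      rw [← Matrix.col, ← Matrix.range_mulVecLin]
      refine ⟨(Q.adjugate * S.BR * M) *ᵥ H, ?_⟩
      rw [Matrix.mulVecLin_apply, Matrix.mulVec_mulVec]
      simp only [Matrix.mul_assoc]
    · have h : (S.BR * M) *ᵥ ((S.NL * Q.adjugate * S.BR * M) *ᵥ H) = Q.det • (S.BR * M) *ᵥ H := by
        rw [Matrix.mulVec_mulVec]
        have : S.BR * M * (S.NL * Q.adjugate * S.BR * M) = Q * Q.adjugate * (S.BR * M) := by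
          rw [hQ]; simp only [Matrix.mul_assoc]
        rw [this, Matrix.mul_adjugate, Matrix.smul_mul, Matrix.one_mul, Matrix.smul_mulVec]
      rw [Matrix.mulVec_mulVec, Matrix.mulVec_add, Matrix.mulVec_neg, Matrix.mulVec_smul, h,
        neg_add_cancel]

theorem Holds.smul {bc : BoundaryCondition d} {v w : Fin (d + 1) → ℂ} (h : bc.Holds v w) (c : ℂ) :
    bc.Holds (c • v) (c • w) := by
  cases bc with
  | periodic => exact congrArg (c • ·) h
  | separated S =>
    exact ⟨by rw [Matrix.mulVec_smul, h.1, smul_zero], by rw [Matrix.mulVec_smul, h.2, smul_zero]⟩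

end BoundaryCondition

/-! ### The inhomogeneous equation -/

namespace DiffExpr

variable {d : ℕ} (D : DiffExpr d)

/-- The integral `∫_0^x U(t)⁻¹ (0, …, 0, F(t) / lead(t)) dt` of Duhamel's formula. -/
noncomputable def duhamel (z : ℂ) (F : ℝ → ℂ) (x : ℝ) : Fin (d + 1) → ℂ := fun j =>
  ∫ t in (0 : ℝ)..x, (D.fundamental z t)⁻¹ j (Fin.last d) * (F t / D.lead t)

/-- The solution of the first-order system with right-hand side `(0, …, 0, F / lead)` and initial
vector `c`. -/
noncomputable def forced (z : ℂ) (F : ℝ → ℂ) (c : Fin (d + 1) → ℂ) (i : Fin (d + 1)) (x : ℝ) : ℂ :=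
  (D.fundamental z x *ᵥ (c + D.duhamel z F x)) i

/-- All but the last row of the companion matrix shift the coordinates. -/
theorem companion_mulVec_castSucc (z : ℂ) (x : ℝ) (w : Fin (d + 1) → ℂ) (i : Fin d) :
    (D.companion z x *ᵥ w) i.castSucc = w i.succ := by
  have h : ∀ j : Fin (d + 1), D.companion z x i.castSucc j = if j = i.succ then 1 else 0 := by
    intro j
    have h1 : i.castSucc ≠ Fin.last d := (Fin.castSucc_lt_last i).ne
    rw [companion, if_neg h1]
    simp only [Fin.val_castSucc, Fin.ext_iff, Fin.val_succ]
  simp only [Matrix.mulVec, dotProduct, h, ite_mul, one_mul, zero_mul, Finset.sum_ite_eq',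
    Finset.mem_univ, if_true]

/-- The last row of the companion matrix expresses `ℒ u = z u`. -/
theorem lead_mul_companion_mulVec_last (z : ℂ) {x : ℝ} (hx : x ∈ Icc 0 D.len)
    (w : Fin (d + 1) → ℂ) :
    D.lead x * (D.companion z x *ᵥ w) (Fin.last d) + ∑ j, D.coeff j x * w j = z * w 0 := by
  have h : ∀ j : Fin (d + 1), D.lead x * (D.companion z x (Fin.last d) j * w j) +
      D.coeff j x * w j = if j = 0 then z * w 0 else 0 := by
    intro j
    have := D.lead_ne x hx
    simp only [companion, if_true]
    split_ifs with hj
    · subst hj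
      field_simp
      ring
    · field_simp
      ring
  simp only [Matrix.mulVec, dotProduct, Finset.mul_sum]
  rw [← Finset.sum_add_distrib, Finset.sum_congr rfl fun j _ => h j]
  simp

variable {D}

theorem continuousOn_mulVec {ι κ : Type*} [Fintype κ] {A : ℝ → Matrix ι κ ℂ} {v : κ → ℝ → ℂ}
    {s : Set ℝ} (hA : ∀ i j, ContinuousOn (fun x => A x i j) s) (hv : ∀ j, ContinuousOn (v j) s)
    (i : ι) : ContinuousOn (fun x => (A x *ᵥ fun j => v j x) i) s :=
  continuousOn_finsetSum _ fun j _ => (hA i j).mul (hv j)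

theorem memLp_of_continuousOn {f : ℝ → ℂ} (hf : ContinuousOn f (Icc 0 D.len)) :
    MemLp f 2 D.vol := by
  obtain ⟨C, hC⟩ := isCompact_Icc.exists_bound_of_continuousOn hf
  exact MemLp.of_bound (hf.aestronglyMeasurable measurableSet_Icc) C
    ((ae_restrict_mem measurableSet_Icc).mono hC)

theorem memLp_div_lead {F : ℝ → ℂ} (hF : MemLp F 2 D.vol) :
    MemLp (fun x => F x / D.lead x) 2 D.vol := by
  have hc : ContinuousOn (fun x => (D.lead x)⁻¹) (Icc 0 D.len) := D.lead_cont.inv₀ D.lead_ne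
  obtain ⟨C, hC⟩ := isCompact_Icc.exists_bound_of_continuousOn hc
  refine MemLp.of_le_mul (c := C) hF ?_ ?_
  · simp only [div_eq_mul_inv]
    exact hF.aestronglyMeasurable.mul (hc.aestronglyMeasurable measurableSet_Icc)
  · filter_upwards [ae_restrict_mem measurableSet_Icc] with x hx
    rw [div_eq_mul_inv, norm_mul, mul_comm]
    exact mul_le_mul_of_nonneg_right (hC x hx) (norm_nonneg _)

theorem integrableOn_div_lead {F : ℝ → ℂ} (hF : MemLp F 2 D.vol) :
    IntegrableOn (fun x => F x / D.lead x) (Icc 0 D.len) :=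
  (memLp_div_lead hF).integrable (by norm_num)

theorem continuousOn_fundamental_inv (z : ℂ) (i j : Fin (d + 1)) :
    ContinuousOn (fun x => (D.fundamental z x)⁻¹ i j) (Icc 0 D.len) :=
  (D.isFundamentalMatrix_fundamental z).continuousOn_inv D.len_pos.le (D.continuousOn_companion z)
    i j

theorem continuousOn_fundamental (z : ℂ) (i j : Fin (d + 1)) :
    ContinuousOn (fun x => D.fundamental z x i j) (Icc 0 D.len) :=
  (D.isFundamentalMatrix_fundamental z).continuousOn i j

theorem integrableOn_duhamel (z : ℂ) {F : ℝ → ℂ} (hF : MemLp F 2 D.vol) (j : Fin (d + 1)) :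
    IntegrableOn (fun t => (D.fundamental z t)⁻¹ j (Fin.last d) * (F t / D.lead t))
      (Icc 0 D.len) :=
  (integrableOn_div_lead hF).continuousOn_mul (continuousOn_fundamental_inv z j _) isCompact_Icc

theorem duhamel_zero (z : ℂ) (F : ℝ → ℂ) : D.duhamel z F 0 = 0 :=
  funext fun _ => intervalIntegral.integral_same

theorem forced_zero (z : ℂ) (F : ℝ → ℂ) (c : Fin (d + 1) → ℂ) (i : Fin (d + 1)) :
    D.forced z F c i 0 = c i := by
  rw [forced, duhamel_zero, (D.isFundamentalMatrix_fundamental z).1, add_zero, Matrix.one_mulVec]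

/-- Duhamel's formula solves the first-order system, in integrated form. -/
theorem forced_eq (z : ℂ) {F : ℝ → ℂ} (hF : MemLp F 2 D.vol) (c : Fin (d + 1) → ℂ)
    (i : Fin (d + 1)) {x : ℝ} (hx : x ∈ Icc 0 D.len) :
    D.forced z F c i x = D.forced z F c i 0 + ∫ t in (0 : ℝ)..x,
      ((D.companion z t *ᵥ fun j => D.forced z F c j t) i +
        if i = Fin.last d then F t / D.lead t else 0) := by
  have hU := D.isFundamentalMatrix_fundamental z
  have hL := D.len_pos.le
  have hA := D.continuousOn_companion z
  have hAU : ∀ i j, ContinuousOn (fun t => (D.companion z t * D.fundamental z t) i j)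
      (Icc 0 D.len) := fun i j => by
    simp only [Matrix.mul_apply]
    exact continuousOn_finsetSum _ fun k _ => (hA i k).mul (continuousOn_fundamental z k j)
  have key := fun j => mul_primitive hL (hAU i j).integrableOn_Icc (integrableOn_duhamel z hF j)
    (eq_add_integral_of_hasDerivWithinAt (fun y hy => hU.2 y hy i j) (hAU i j))
    (g := fun y => c j + D.duhamel z F y j) (fun y hy => by
      rw [duhamel_zero, Pi.zero_apply, add_zero]; rfl)
  change ∑ j, D.fundamental z x i j * (c j + D.duhamel z F x j) =
    ∑ j, D.fundamental z 0 i j * (c j + D.duhamel z F 0 j) + _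
  rw [Finset.sum_congr rfl fun j _ => (key j).2 x hx, Finset.sum_add_distrib,
    ← intervalIntegral.integral_finsetSum fun j _ => intervalIntegrable_of_Icc (key j).1 hx]
  congr 1
  refine intervalIntegral.integral_congr fun t ht => ?_
  rw [uIcc_of_le hx.1] at ht
  have ht' : t ∈ Icc 0 D.len := ⟨ht.1, ht.2.trans hx.2⟩
  change ∑ j, _ = _
  rw [Finset.sum_add_distrib]
  refine congrArg₂ (· + ·) ?_ ?_
  · change ((D.companion z t * D.fundamental z t) *ᵥ (c + D.duhamel z F t)) i =
      (D.companion z t *ᵥ (D.fundamental z t *ᵥ (c + D.duhamel z F t))) i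
    rw [Matrix.mulVec_mulVec]
  · simp only [← mul_assoc]
    rw [← Finset.sum_mul]
    change (D.fundamental z t * (D.fundamental z t)⁻¹) i (Fin.last d) * _ = _
    rw [hU.mul_inv hL hA ht', Matrix.one_apply, ite_mul, one_mul, zero_mul]

theorem continuousOn_forced (z : ℂ) {F : ℝ → ℂ} (hF : MemLp F 2 D.vol) (c : Fin (d + 1) → ℂ)
    (i : Fin (d + 1)) : ContinuousOn (D.forced z F c i) (Icc 0 D.len) := by
  refine continuousOn_mulVec (v := fun j y => c j + D.duhamel z F y j)
    (continuousOn_fundamental z) (fun j => ?_) i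
  exact continuousOn_of_primitive D.len_pos.le (integrableOn_duhamel z hF j) fun y _ => by
    rw [duhamel_zero, Pi.zero_apply, add_zero]; rfl

theorem isJet_forced (z : ℂ) {F : ℝ → ℂ} (hF : MemLp F 2 D.vol) (c : Fin (d + 1) → ℂ) :
    D.IsJet (D.forced z F c) fun x =>
      (D.companion z x *ᵥ fun j => D.forced z F c j x) (Fin.last d) + F x / D.lead x where
  memLp := (memLp_of_continuousOn (continuousOn_mulVec (D.continuousOn_companion z)
    (continuousOn_forced z hF c) _)).add (memLp_div_lead hF)
  step i x hx := by
    rw [forced_eq z hF c _ hx]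
    simp only [companion_mulVec_castSucc, if_neg (Fin.castSucc_lt_last i).ne, add_zero]
  top x hx := by
    rw [forced_eq z hF c _ hx]
    simp only [if_true]

/-- The scalar equation `ℒ u = z u + F` for the solution of the forced system. -/
theorem forced_equation (z : ℂ) (F : ℝ → ℂ) (c : Fin (d + 1) → ℂ) {x : ℝ}
    (hx : x ∈ Icc 0 D.len) :
    D.lead x * ((D.companion z x *ᵥ fun j => D.forced z F c j x) (Fin.last d) + F x / D.lead x) +
      ∑ j, D.coeff j x * D.forced z F c j x = z * D.forced z F c 0 x + F x := by
  rw [← D.lead_mul_companion_mulVec_last z hx fun j => D.forced z F c j x, mul_add,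
    mul_div_cancel₀ _ (D.lead_ne x hx)]
  ring

/-- A weak solution of the homogeneous equation is a classical one. -/
theorem IsJet.eq_fundamental_mulVec {v : Fin (d + 1) → ℝ → ℂ} {g : ℝ → ℂ} (h : D.IsJet v g) {z : ℂ}
    (hz : ∀ᵐ x ∂D.vol, D.lead x * g x + ∑ j, D.coeff j x * v j x = z * v 0 x) :
    ∀ x ∈ Icc 0 D.len, (fun i => v i x) = D.fundamental z x *ᵥ fun i => v i 0 := by
  have hg : ∀ᵐ x ∂D.vol, g x = (D.companion z x *ᵥ fun j => v j x) (Fin.last d) := by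
    filter_upwards [hz, ae_restrict_mem measurableSet_Icc] with x hx hxI
    rw [← D.lead_mul_companion_mulVec_last z hxI fun j => v j x, add_left_inj] at hx
    exact mul_left_cancel₀ (D.lead_ne x hxI) hx
  have hprim : ∀ i, ∀ x ∈ Icc 0 D.len,
      v i x = v i 0 + ∫ t in (0 : ℝ)..x, (D.companion z t *ᵥ fun j => v j t) i := by
    intro i x hx
    induction i using Fin.lastCases with
    | cast i =>
      rw [h.step i x hx]
      simp only [companion_mulVec_castSucc]
    | last =>
      rw [h.top x hx, intervalIntegral.integral_of_le hx.1, intervalIntegral.integral_of_le hx.1]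
      refine congrArg _ (integral_congr_ae ?_)
      exact ae_restrict_of_ae_restrict_of_subset
        (Ioc_subset_Icc_self.trans (Icc_subset_Icc_right hx.2)) hg
  exact (D.isFundamentalMatrix_fundamental z).eq_mulVec D.len_pos.le (D.continuousOn_companion z)
    fun x hx i => hasDerivWithinAt_of_primitive
      (continuousOn_mulVec (D.continuousOn_companion z) h.continuousOn i) (hprim i) x hx

/-- Derivatives of a function that vanishes almost everywhere vanish. -/
theorem IsJet.eq_zero_of_ae {v : Fin (d + 1) → ℝ → ℂ} {g : ℝ → ℂ} (h : D.IsJet v g)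
    (h0 : v 0 =ᵐ[D.vol] 0) (i : Fin (d + 1)) : ∀ x ∈ Icc 0 D.len, v i x = 0 := by
  have up : ∀ i, v i =ᵐ[D.vol] 0 → ∀ x ∈ Icc 0 D.len, v i x = 0 := fun i hi =>
    Measure.eqOn_Icc_of_ae_eq volume D.len_pos.ne hi (h.continuousOn i) continuousOn_const
  induction i using Fin.induction with
  | zero => exact up 0 h0
  | succ i ih =>
    refine up _ (ae_zero_of_primitive_zero D.len_pos (h.continuousOn _).integrableOn_Icc
      fun x hx => ?_)
    have := h.step i x hx
    rwa [ih x hx, ih 0 ⟨le_rfl, D.len_pos.le⟩, zero_add, eq_comm] at this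

/-! ### The Green's kernel -/

variable (D) in
/-- The scalar kernel `[U(x) Q U(y)⁻¹]_{1n} / lead(y)` with a constant matrix `Q`. The Green's
kernel is such a kernel on either side of the diagonal. -/
noncomputable def matKernel (z : ℂ) (Q : Matrix (Fin (d + 1)) (Fin (d + 1)) ℂ) (x y : ℝ) : ℂ :=
  (D.fundamental z x * Q * (D.fundamental z y)⁻¹) 0 (Fin.last d) / D.lead y

variable (D) in
/-- The matrix of the Green's kernel below the diagonal, `y < x`. -/
noncomputable def lowerMatrix (bc : BoundaryCondition d) (z : ℂ) :
    Matrix (Fin (d + 1)) (Fin (d + 1)) ℂ :=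
  D.evans bc z • (1 : Matrix (Fin (d + 1)) (Fin (d + 1)) ℂ) - bc.projMatrix (D.monodromy z)

variable (D) in
/-- The matrix of the Green's kernel above the diagonal, `x ≤ y`. -/
noncomputable def upperMatrix (bc : BoundaryCondition d) (z : ℂ) :
    Matrix (Fin (d + 1)) (Fin (d + 1)) ℂ :=
  -bc.projMatrix (D.monodromy z)

theorem green_eq_ite (bc : BoundaryCondition d) (z : ℂ) (x y : ℝ) :
    D.green bc z x y = if y < x then D.matKernel z (D.lowerMatrix bc z) x y
      else D.matKernel z (D.upperMatrix bc z) x y := by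
  unfold green greenMatrix matKernel lowerMatrix upperMatrix
  split_ifs
  · rfl
  · rw [Matrix.mul_neg, Matrix.neg_mul]

theorem matKernel_eq_sum (z : ℂ) (Q : Matrix (Fin (d + 1)) (Fin (d + 1)) ℂ) (x y : ℝ) :
    D.matKernel z Q x y = ∑ j, (D.fundamental z x * Q) 0 j *
      ((D.fundamental z y)⁻¹ j (Fin.last d) * (D.lead y)⁻¹) := by
  rw [matKernel, Matrix.mul_apply, div_eq_mul_inv, Finset.sum_mul]
  simp only [mul_assoc]

theorem continuousOn_matKernel (z : ℂ) (Q : Matrix (Fin (d + 1)) (Fin (d + 1)) ℂ) :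
    ContinuousOn (fun p : ℝ × ℝ => D.matKernel z Q p.1 p.2) (Icc 0 D.len ×ˢ Icc 0 D.len) := by
  simp only [matKernel_eq_sum, Matrix.mul_apply]
  refine continuousOn_finsetSum _ fun j _ => ContinuousOn.mul
    (continuousOn_finsetSum _ fun k _ => ContinuousOn.mul ?_ continuousOn_const) ?_
  · exact (continuousOn_fundamental z 0 k).comp continuousOn_fst fun p hp => hp.1
  · exact ((continuousOn_fundamental_inv z j _).mul (D.lead_cont.inv₀ D.lead_ne)).comp
      continuousOn_snd fun p hp => hp.2

theorem continuousOn_matKernel_right (z : ℂ) (Q : Matrix (Fin (d + 1)) (Fin (d + 1)) ℂ) (x : ℝ) :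
    ContinuousOn (fun y => D.matKernel z Q x y) (Icc 0 D.len) := by
  simp only [matKernel_eq_sum]
  exact continuousOn_finsetSum _ fun j _ => continuousOn_const.mul
    ((continuousOn_fundamental_inv z j _).mul (D.lead_cont.inv₀ D.lead_ne))

theorem integral_matKernel_mul (z : ℂ) (Q : Matrix (Fin (d + 1)) (Fin (d + 1)) ℂ) {F : ℝ → ℂ}
    (hF : MemLp F 2 D.vol) {a b : ℝ} (ha : a ∈ Icc 0 D.len) (hb : b ∈ Icc 0 D.len) (x : ℝ) :
    ∫ t in a..b, D.matKernel z Q x t * F t =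
      (D.fundamental z x *ᵥ (Q *ᵥ (D.duhamel z F b - D.duhamel z F a))) 0 := by
  have hi := fun j => intervalIntegrable_of_Icc (integrableOn_duhamel z hF j) ha
  have hi' := fun j => intervalIntegrable_of_Icc (integrableOn_duhamel z hF j) hb
  have e : ∀ t, D.matKernel z Q x t * F t = ∑ j, (D.fundamental z x * Q) 0 j *
      ((D.fundamental z t)⁻¹ j (Fin.last d) * (F t / D.lead t)) := by
    intro t
    rw [matKernel_eq_sum, Finset.sum_mul]
    exact Finset.sum_congr rfl fun j _ => by ring
  simp only [e]
  rw [intervalIntegral.integral_finsetSum fun j _ =>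
    (((hi j).symm.trans (hi' j)).const_mul _), Matrix.mulVec_mulVec]
  refine Finset.sum_congr rfl fun j _ => ?_
  rw [intervalIntegral.integral_const_mul, Pi.sub_apply]
  congr 1
  exact (intervalIntegral.integral_interval_sub_left (hi' j) (hi j)).symm

variable (D) in
/-- The initial vector for which Duhamel's formula satisfies the boundary condition. -/
noncomputable def initialVector (bc : BoundaryCondition d) (z : ℂ) (F : ℝ → ℂ) : Fin (d + 1) → ℂ :=
  (D.evans bc z)⁻¹ • -(bc.projMatrix (D.monodromy z) *ᵥ D.duhamel z F D.len)

theorem holds_forced (bc : BoundaryCondition d) {z : ℂ} (hE : D.evans bc z ≠ 0) (F : ℝ → ℂ) :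
    bc.Holds (fun i => D.forced z F (D.initialVector bc z F) i 0)
      (fun i => D.forced z F (D.initialVector bc z F) i D.len) := by
  have h := (bc.holds_projMatrix (D.monodromy z) (D.duhamel z F D.len)).smul (D.evans bc z)⁻¹
  rw [← Matrix.mulVec_smul, smul_add] at h
  change bc.Holds _ (D.monodromy z *ᵥ (D.initialVector bc z F +
    (D.evans bc z)⁻¹ • D.evans bc z • D.duhamel z F D.len)) at h
  rw [inv_smul_smul₀ hE] at h
  simp only [forced_zero]
  exact h

/-- The two parts of the Green's kernel, integrated over `y < x` (giving `h`) and `y > x` (giving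
`H - h`), add up to Duhamel's formula with initial vector `-P H / e`. -/
theorem mulVec_lower_add_mulVec_upper {ι : Type*} [Fintype ι] [DecidableEq ι] {e : ℂ} (he : e ≠ 0)
    (U P : Matrix ι ι ℂ) (h H : ι → ℂ) :
    U *ᵥ ((e • (1 : Matrix ι ι ℂ) - P) *ᵥ h) + U *ᵥ (-P *ᵥ (H - h)) =
      e • (U *ᵥ (e⁻¹ • -(P *ᵥ H) + h)) := by
  rw [← Matrix.mulVec_add, ← Matrix.mulVec_smul, smul_add, smul_inv_smul₀ he, Matrix.sub_mulVec,
    Matrix.smul_mulVec, Matrix.one_mulVec, Matrix.neg_mulVec, Matrix.mulVec_sub]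
  congr 1
  abel

/-- The solution satisfying the boundary condition is the integral against the Green's kernel. -/
theorem integral_green_mul (bc : BoundaryCondition d) {z : ℂ} (hE : D.evans bc z ≠ 0) {F : ℝ → ℂ}
    (hF : MemLp F 2 D.vol) {x : ℝ} (hx : x ∈ Icc 0 D.len) :
    ∫ y in (0 : ℝ)..D.len, D.green bc z x y * F y =
      D.evans bc z * D.forced z F (D.initialVector bc z F) 0 x := by
  have h0 : (0 : ℝ) ∈ Icc 0 D.len := ⟨le_rfl, D.len_pos.le⟩
  have hL : D.len ∈ Icc 0 D.len := ⟨D.len_pos.le, le_rfl⟩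
  have hFi : IntegrableOn F (Icc 0 D.len) := hF.integrable (by norm_num)
  have hk : ∀ Q, IntegrableOn (fun y => D.matKernel z Q x y * F y) (Icc 0 D.len) := by
    intro Q
    exact hFi.continuousOn_mul (continuousOn_matKernel_right z Q x) isCompact_Icc
  have hki : ∀ Q, ∀ b ∈ Icc 0 D.len, IntervalIntegrable
      (fun y => D.matKernel z Q x y * F y) volume 0 b := fun Q b hb =>
    intervalIntegrable_of_Icc (hk Q) hb
  -- The diagonal `y = x` is a null set, so its side does not matter.
  have e1 : EqOn (fun y => D.matKernel z (D.lowerMatrix bc z) x y * F y)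
      (fun y => D.green bc z x y * F y) (Ioo 0 x) := fun y hy => by
    simp only [green_eq_ite, if_pos hy.2]
  have e2 : EqOn (fun y => D.matKernel z (D.upperMatrix bc z) x y * F y)
      (fun y => D.green bc z x y * F y) (Ioc x D.len) := fun y hy => by
    simp only [green_eq_ite, if_neg (not_lt.2 hy.1.le)]
  have i1 : ∫ y in (0 : ℝ)..x, D.green bc z x y * F y =
      ∫ y in (0 : ℝ)..x, D.matKernel z (D.lowerMatrix bc z) x y * F y := by
    rw [intervalIntegral.integral_of_le hx.1, intervalIntegral.integral_of_le hx.1,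
      integral_Ioc_eq_integral_Ioo, integral_Ioc_eq_integral_Ioo]
    exact setIntegral_congr_fun measurableSet_Ioo e1.symm
  have i2 : ∫ y in x..D.len, D.green bc z x y * F y =
      ∫ y in x..D.len, D.matKernel z (D.upperMatrix bc z) x y * F y := by
    rw [intervalIntegral.integral_of_le hx.2, intervalIntegral.integral_of_le hx.2]
    exact setIntegral_congr_fun measurableSet_Ioc e2.symm
  have n1 : IntervalIntegrable (fun y => D.green bc z x y * F y) volume 0 x := by
    have := hki (D.lowerMatrix bc z) x hx
    rw [intervalIntegrable_iff_integrableOn_Ioo_of_le hx.1] at this ⊢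
    exact this.congr_fun e1 measurableSet_Ioo
  have n2 : IntervalIntegrable (fun y => D.green bc z x y * F y) volume x D.len := by
    have := (hki (D.upperMatrix bc z) x hx).symm.trans (hki (D.upperMatrix bc z) _ hL)
    rw [intervalIntegrable_iff_integrableOn_Ioc_of_le hx.2] at this ⊢
    exact this.congr_fun e2 measurableSet_Ioc
  rw [← intervalIntegral.integral_add_adjacent_intervals n1 n2, i1, i2,
    integral_matKernel_mul z _ hF h0 hx, integral_matKernel_mul z _ hF hx hL, duhamel_zero,
    sub_zero]
  exact congrFun (mulVec_lower_add_mulVec_upper hE (D.fundamental z x) _ _ _) 0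

end DiffExpr

/-! ### Hilbert–Schmidt integral operators -/

section HilbertSchmidt

variable {α : Type*} {m : MeasurableSpace α} {μ : Measure α}

theorem norm_integral_mul_sq_le {k F : α → ℂ} (hk : MemLp k 2 μ) (hF : MemLp F 2 μ) :
    ‖∫ x, k x * F x ∂μ‖ ^ 2 ≤ (∫ x, ‖k x‖ ^ 2 ∂μ) * ∫ x, ‖F x‖ ^ 2 ∂μ := by
  have h1 : ‖∫ x, k x * F x ∂μ‖ ≤ ∫ x, ‖k x‖ * ‖F x‖ ∂μ :=
    (norm_integral_le_integral_norm _).trans_eq (by simp only [norm_mul])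
  have h2 := integral_mul_norm_le_Lp_mul_Lq (μ := μ) (f := k) (g := F) Real.HolderConjugate.two_two
    (by simpa using hk) (by simpa using hF)
  simp only [Real.rpow_two, ← Real.sqrt_eq_rpow] at h2
  have ha : 0 ≤ ∫ x, ‖k x‖ ^ 2 ∂μ := integral_nonneg fun _ => sq_nonneg _
  have hb : 0 ≤ ∫ x, ‖F x‖ ^ 2 ∂μ := integral_nonneg fun _ => sq_nonneg _
  refine (pow_le_pow_left₀ (norm_nonneg _) (h1.trans h2) 2).trans_eq ?_
  rw [mul_pow, Real.sq_sqrt ha, Real.sq_sqrt hb]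

/-- An integral operator is bounded on `L²` by the `L²` norm of its kernel. -/
theorem integral_norm_integral_mul_sq_le [SFinite μ] {k : α → α → ℂ}
    (hk : MemLp (Function.uncurry k) 2 (μ.prod μ)) {F : α → ℂ} (hF : MemLp F 2 μ) :
    ∫ x, ‖∫ y, k x y * F y ∂μ‖ ^ 2 ∂μ ≤
      (∫ x, ∫ y, ‖k x y‖ ^ 2 ∂μ ∂μ) * ∫ y, ‖F y‖ ^ 2 ∂μ := by
  have hsq : Integrable (fun p : α × α => ‖k p.1 p.2‖ ^ 2) (μ.prod μ) :=
    (memLp_two_iff_integrable_sq_norm hk.aestronglyMeasurable).1 hk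
  rw [← integral_mul_const]
  refine integral_mono_of_nonneg (Filter.Eventually.of_forall fun _ => sq_nonneg _)
    (hsq.integral_prod_left.mul_const _) ?_
  filter_upwards [hsq.prod_right_ae, hk.aestronglyMeasurable.prodMk_left] with x hx hm
  exact norm_integral_mul_sq_le ((memLp_two_iff_integrable_sq_norm hm).2 hx) hF

theorem lp_two_norm_sq (f : Lp ℂ 2 μ) : ‖f‖ ^ 2 = ∫ x, ‖f x‖ ^ 2 ∂μ := by
  have h := inner_self_eq_norm_sq (𝕜 := ℂ) f
  rw [L2.inner_def] at h
  have e : ∀ x, inner ℂ (f x) (f x) = ((‖f x‖ ^ 2 : ℝ) : ℂ) := fun x => by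
    rw [inner_self_eq_norm_sq_to_K]
    norm_cast
  simp only [e] at h
  rw [← h, integral_complex_ofReal]
  simp

end HilbertSchmidt

/-! ### Resolvents of unbounded operators -/

section Resolvent

variable {X : Type*} [NormedAddCommGroup X] [NormedSpace ℂ X] {T : X →ₗ.[ℂ] X} {z w : ℂ}
  {R R' : X →L[ℂ] X}

theorem IsResolventAt.unique (h : IsResolventAt T z R) (h' : IsResolventAt T z R') : R = R' := by
  ext f
  obtain ⟨hd, hf⟩ := h'.1 f
  have := h.2 ⟨R' f, hd⟩
  rwa [hf] at this

/-- If `T - z` is injective and every `f` has a preimage of norm at most `C ‖f‖`, then the resolvent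
exists and has norm at most `C`. -/
theorem exists_isResolventAt {C : ℝ} (hC : 0 ≤ C)
    (hsurj : ∀ f, ∃ u : T.domain, T u - z • (u : X) = f ∧ ‖(u : X)‖ ≤ C * ‖f‖)
    (hinj : ∀ u : T.domain, T u - z • (u : X) = 0 → u = 0) :
    ∃ R : X →L[ℂ] X, IsResolventAt T z R ∧ ‖R‖ ≤ C := by
  let S : T.domain →ₗ[ℂ] X := T.toFun - z • T.domain.subtype
  have hS : ∀ u : T.domain, S u = T u - z • (u : X) := fun _ => rfl
  let e : T.domain ≃ₗ[ℂ] X := LinearEquiv.ofBijective S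
    ⟨(injective_iff_map_eq_zero S).2 fun u hu => hinj u hu, fun f => (hsurj f).imp fun u hu => hu.1⟩
  have he : ∀ u, e u = S u := fun _ => rfl
  have hb : ∀ f, ‖(T.domain.subtype ∘ₗ e.symm.toLinearMap) f‖ ≤ C * ‖f‖ := by
    intro f
    obtain ⟨u, hu, hn⟩ := hsurj f
    have : e.symm f = u := e.symm_apply_eq.2 hu.symm
    change ‖((e.symm f : T.domain) : X)‖ ≤ _
    rwa [this]
  refine ⟨(T.domain.subtype ∘ₗ e.symm.toLinearMap).mkContinuous C hb, ⟨fun f => ?_, fun u => ?_⟩,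
    LinearMap.mkContinuous_norm_le _ hC hb⟩
  · refine ⟨(e.symm f).2, ?_⟩
    have := e.apply_symm_apply f
    rwa [he, hS] at this
  · change ((e.symm (T u - z • (u : X)) : T.domain) : X) = u
    rw [← hS, ← he, e.symm_apply_apply]

/-- The resolvent set contains the disk of radius `1 / ‖R‖` around `z`: there
`R (1 - (w - z) R)⁻¹` is the resolvent at `w`, by the Neumann series. -/
theorem IsResolventAt.mem_of_norm_lt [CompleteSpace X] (h : IsResolventAt T z R)
    (hw : ‖w - z‖ * ‖R‖ < 1) : w ∈ unboundedResolventSet T := by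
  rw [← norm_smul] at hw
  obtain ⟨B, hB⟩ := isUnit_one_sub_of_norm_lt_one hw
  have hBg : ∀ g, (B : X →L[ℂ] X) g = g - (w - z) • R g := fun g => by rw [hB]; rfl
  obtain ⟨S, hS⟩ : ∃ S : X →L[ℂ] X, S = (B⁻¹ : (X →L[ℂ] X)ˣ) := ⟨_, rfl⟩
  have h1 : ∀ g, (B : X →L[ℂ] X) (S g) = g := fun g => by
    rw [hS]; exact congrArg (fun A : X →L[ℂ] X => A g) B.mul_inv
  have h2 : ∀ g, S ((B : X →L[ℂ] X) g) = g := fun g => by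
    rw [hS]; exact congrArg (fun A : X →L[ℂ] X => A g) B.inv_mul
  refine ⟨R.comp S, fun f => ?_, fun u => ?_⟩
  · obtain ⟨hd, hf⟩ := h.1 (S f)
    refine ⟨hd, ?_⟩
    have e := h1 f
    rw [hBg] at e
    calc T ⟨R (S f), hd⟩ - w • R (S f) = (T ⟨R (S f), hd⟩ - z • R (S f)) - (w - z) • R (S f) := by
          rw [sub_smul]; abel
      _ = f := by rw [hf, e]
  · have e : T u - w • (u : X) = (B : X →L[ℂ] X) (T u - z • (u : X)) := by
      rw [hBg, h.2 u, sub_smul]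
      abel
    rw [ContinuousLinearMap.comp_apply, e, h2, h.2 u]

end Resolvent

namespace DiffExpr

variable {d : ℕ} {D : DiffExpr d} {bc : BoundaryCondition d} {z : ℂ}

/-! ### The resolvent of the differential operator -/

theorem vol_prod : D.vol.prod D.vol =
    (volume : Measure (ℝ × ℝ)).restrict (Icc 0 D.len ×ˢ Icc 0 D.len) := by
  rw [Measure.prod_restrict]
  rfl

theorem measurableSet_lower : MeasurableSet {p : ℝ × ℝ | p.2 < p.1} :=
  measurableSet_lt measurable_snd measurable_fst

theorem memLp_green (D : DiffExpr d) (bc : BoundaryCondition d) (z : ℂ) :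
    MemLp (Function.uncurry (D.green bc z)) 2 (D.vol.prod D.vol) := by
  have hmeas : ∀ Q, AEStronglyMeasurable (fun p : ℝ × ℝ => D.matKernel z Q p.1 p.2)
      (D.vol.prod D.vol) := fun Q => by
    rw [vol_prod]
    exact (continuousOn_matKernel z Q).aestronglyMeasurable
      (measurableSet_Icc.prod measurableSet_Icc)
  have hbd : ∀ Q, ∃ C, ∀ p ∈ Icc 0 D.len ×ˢ Icc 0 D.len, ‖D.matKernel z Q p.1 p.2‖ ≤ C := fun Q =>
    (isCompact_Icc.prod isCompact_Icc).exists_bound_of_continuousOn (continuousOn_matKernel z Q)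
  obtain ⟨C₁, h₁⟩ := hbd (D.lowerMatrix bc z)
  obtain ⟨C₂, h₂⟩ := hbd (D.upperMatrix bc z)
  classical
  have e : Function.uncurry (D.green bc z) = {p : ℝ × ℝ | p.2 < p.1}.piecewise
      (fun p => D.matKernel z (D.lowerMatrix bc z) p.1 p.2)
      (fun p => D.matKernel z (D.upperMatrix bc z) p.1 p.2) := by
    funext p
    simp only [Function.uncurry, green_eq_ite, Set.piecewise, mem_ofPred_eq]
  refine MemLp.of_bound (e ▸ AEStronglyMeasurable.piecewise measurableSet_lower
    (hmeas _).restrict (hmeas _).restrict) (max C₁ C₂) ?_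
  rw [vol_prod]
  filter_upwards [ae_restrict_mem (measurableSet_Icc.prod measurableSet_Icc)] with p hp
  simp only [Function.uncurry, green_eq_ite]
  split_ifs
  · exact (h₁ p hp).trans (le_max_left _ _)
  · exact (h₂ p hp).trans (le_max_right _ _)

theorem intervalIntegral_eq_vol {E : Type*} [NormedAddCommGroup E] [NormedSpace ℝ E] (f : ℝ → E) :
    ∫ x in (0 : ℝ)..D.len, f x = ∫ x, f x ∂D.vol := by
  rw [intervalIntegral.integral_of_le D.len_pos.le, integral_Icc_eq_integral_Ioc]

theorem weight_sq (D : DiffExpr d) (bc : BoundaryCondition d) (z : ℂ) :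
    D.weight bc z ^ 2 = ∫ x, ∫ y, ‖D.green bc z x y‖ ^ 2 ∂D.vol ∂D.vol := by
  simp only [weight, intervalIntegral_eq_vol]
  exact Real.sq_sqrt (integral_nonneg fun x => integral_nonneg fun y => sq_nonneg _)

theorem weight_nonneg (D : DiffExpr d) (bc : BoundaryCondition d) (z : ℂ) : 0 ≤ D.weight bc z :=
  Real.sqrt_nonneg _

/-- When the Evans function does not vanish, `(ℒ - z) u = f` has a solution, bounded by the
Hilbert–Schmidt norm `W / |E|` of the kernel `G / E`. -/
theorem exists_mem_graph (hE : D.evans bc z ≠ 0) (f : D.H) :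
    ∃ u : D.H, (u, z • u + f) ∈ D.graph bc ∧ ‖u‖ ≤ D.weight bc z / ‖D.evans bc z‖ * ‖f‖ := by
  have hf : MemLp (f : ℝ → ℂ) 2 D.vol := Lp.memLp f
  set c := D.initialVector bc z f
  have hu : MemLp (D.forced z f c 0) 2 D.vol := memLp_of_continuousOn (continuousOn_forced z hf c 0)
  refine ⟨hu.toLp _, ⟨_, _, isJet_forced z hf c, holds_forced bc hE f, hu.coeFn_toLp, ?_⟩, ?_⟩
  · filter_upwards [Lp.coeFn_add (z • hu.toLp _) f, Lp.coeFn_smul z (hu.toLp _), hu.coeFn_toLp,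
      ae_restrict_mem measurableSet_Icc] with x h1 h2 h3 hx
    rw [forced_equation z f c hx]
    change (z • hu.toLp _ + f : D.H) x = _
    rw [h1, Pi.add_apply, h2, Pi.smul_apply, h3, smul_eq_mul]
  · have hE' : 0 < ‖D.evans bc z‖ := norm_pos_iff.2 hE
    rw [div_mul_eq_mul_div, le_div_iff₀ hE']
    refine le_of_sq_le_sq ?_ (mul_nonneg (D.weight_nonneg bc z) (norm_nonneg _))
    rw [mul_pow, mul_pow, weight_sq, lp_two_norm_sq f, lp_two_norm_sq]
    refine le_trans (le_of_eq ?_) (integral_norm_integral_mul_sq_le (D.memLp_green bc z) hf)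
    rw [← integral_mul_const]
    refine integral_congr_ae ?_
    filter_upwards [hu.coeFn_toLp, ae_restrict_mem measurableSet_Icc] with x h1 hx
    rw [h1, ← intervalIntegral_eq_vol, integral_green_mul bc hE hf hx, norm_mul, mul_pow, mul_comm]

theorem eq_zero_of_mem_graph (hE : D.evans bc z ≠ 0) {u : D.H} (hu : (u, z • u) ∈ D.graph bc) :
    u = 0 := by
  obtain ⟨v, g, hj, hb, h1, h2⟩ := hu
  have hv := hj.eq_fundamental_mulVec (z := z) (by
    filter_upwards [h1, h2, Lp.coeFn_smul z u] with x e1 e2 e3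
    rw [← e2, ← e1]
    exact e3)
  have h0 : (fun i => v i 0) = 0 := by
    by_contra hne
    refine hE ((bc.evans_eq_zero_iff _).2 ⟨_, hne, ?_⟩)
    rw [hv D.len ⟨D.len_pos.le, le_rfl⟩] at hb
    exact hb
  refine Lp.ext (h1.trans ?_)
  filter_upwards [ae_restrict_mem measurableSet_Icc, Lp.coeFn_zero ℂ 2 D.vol] with x hx hx0
  have := congrFun (hv x hx) 0
  rw [h0, Matrix.mulVec_zero] at this
  rw [hx0]
  exact this

/-- At a zero of the Evans function the operator has an eigenvector: the homogeneous solution whose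
initial vector satisfies the boundary condition together with its image under the monodromy
matrix. -/
theorem exists_eigenvector (hE : D.evans bc z = 0) :
    ∃ u : D.H, u ≠ 0 ∧ (u, z • u) ∈ D.graph bc := by
  obtain ⟨c, hc, hb⟩ := (bc.evans_eq_zero_iff _).1 hE
  have h0 : MemLp (0 : ℝ → ℂ) 2 D.vol := MemLp.zero
  have hu : MemLp (D.forced z 0 c 0) 2 D.vol := memLp_of_continuousOn (continuousOn_forced z h0 c 0)
  have hj := isJet_forced z h0 c
  have hL : (fun i => D.forced z 0 c i D.len) = D.monodromy z *ᵥ c := by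
    have : D.duhamel z 0 D.len = 0 := by
      funext j
      simp [duhamel]
    funext i
    rw [forced, this, add_zero]
    rfl
  refine ⟨hu.toLp _, fun hz => hc ?_, _, _, hj, ?_, hu.coeFn_toLp, ?_⟩
  · have hae : D.forced z 0 c 0 =ᵐ[D.vol] 0 := by
      refine hu.coeFn_toLp.symm.trans ?_
      rw [hz]
      exact Lp.coeFn_zero ..
    funext i
    have := hj.eq_zero_of_ae hae i 0 ⟨le_rfl, D.len_pos.le⟩
    rwa [forced_zero] at this
  · rw [hL]
    simpa only [forced_zero] using hb
  · filter_upwards [Lp.coeFn_smul z (hu.toLp _), hu.coeFn_toLp,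
      ae_restrict_mem measurableSet_Icc] with x h2 h3 hx
    rw [forced_equation z 0 c hx]
    change (z • hu.toLp _ : D.H) x = _
    rw [h2, Pi.smul_apply, h3, smul_eq_mul, Pi.zero_apply, add_zero]

theorem exists_domain_of_mem_graph {u f : D.H} (h : (u, f) ∈ D.graph bc) :
    ∃ y : (D.operator bc).domain, (y : D.H) = u ∧ D.operator bc y = f := by
  rw [← operator_graph] at h
  exact (LinearPMap.mem_graph_iff _).1 h

theorem mem_graph (y : (D.operator bc).domain) : ((y : D.H), D.operator bc y) ∈ D.graph bc := by
  rw [← operator_graph]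
  exact (D.operator bc).mem_graph y

theorem exists_resolvent (hE : D.evans bc z ≠ 0) : ∃ R : D.H →L[ℂ] D.H,
    IsResolventAt (D.operator bc) z R ∧ ‖R‖ ≤ D.weight bc z / ‖D.evans bc z‖ := by
  refine exists_isResolventAt (div_nonneg (D.weight_nonneg bc z) (norm_nonneg _)) ?_ ?_
  · intro f
    obtain ⟨u, hu, hn⟩ := exists_mem_graph hE f
    obtain ⟨y, rfl, hy⟩ := exists_domain_of_mem_graph hu
    exact ⟨y, by rw [hy, add_sub_cancel_left], hn⟩
  · intro u hu
    have h := mem_graph u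
    rw [sub_eq_zero.1 hu] at h
    exact Subtype.ext (eq_zero_of_mem_graph hE h)

theorem evans_ne_zero {R : D.H →L[ℂ] D.H} (hR : IsResolventAt (D.operator bc) z R) :
    D.evans bc z ≠ 0 := by
  intro hE
  obtain ⟨u, hu0, hu⟩ := exists_eigenvector hE
  obtain ⟨y, rfl, hy⟩ := exists_domain_of_mem_graph hu
  have := hR.2 y
  rw [hy, sub_self, map_zero] at this
  exact hu0 this.symm

theorem norm_resolvent_le {R : D.H →L[ℂ] D.H} (hR : IsResolventAt (D.operator bc) z R) :
    ‖R‖ ≤ D.weight bc z / ‖D.evans bc z‖ := by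
  obtain ⟨R', hR', hn⟩ := exists_resolvent (evans_ne_zero hR)
  rwa [hR.unique hR']

theorem exists_ne_zero (D : DiffExpr d) : ∃ f : D.H, f ≠ 0 := by
  have h : D.vol Set.univ ≠ 0 := by
    simp [D.len_pos]
  refine ⟨indicatorConstLp 2 MeasurableSet.univ (measure_ne_top _ _) (1 : ℂ), fun h0 => ?_⟩
  have := congrArg norm h0
  rw [norm_indicatorConstLp (by norm_num) (by norm_num), norm_zero, norm_one, one_mul] at this
  rw [Real.rpow_eq_zero measureReal_nonneg (by norm_num)] at this
  exact h ((measureReal_eq_zero_iff).1 this)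

/-- If the weight vanished, the resolvent would be zero, although it is the inverse of a surjective
map onto a nonzero space. -/
theorem weight_pos {R : D.H →L[ℂ] D.H} (hR : IsResolventAt (D.operator bc) z R) :
    0 < D.weight bc z := by
  refine (D.weight_nonneg bc z).lt_of_ne fun h0 => ?_
  obtain ⟨f, hf⟩ := D.exists_ne_zero
  have hn := norm_resolvent_le hR
  rw [← h0, zero_div, norm_le_zero_iff] at hn
  subst hn
  obtain ⟨hd, hT⟩ := hR.1 f
  refine hf (hT.symm.trans ?_)
  have : (⟨(0 : D.H →L[ℂ] D.H) f, hd⟩ : (D.operator bc).domain) = 0 := rfl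
  rw [this, LinearPMap.map_zero, zero_apply, smul_zero, sub_zero]

end DiffExpr

/-! ### Analytic dependence on the spectral parameter -/

section Volterra

variable {R : Type*} [NormedRing R] [NormedAlgebra ℂ R] {L : ℝ}

/-- The Volterra operator `f ↦ ∫_0^x f` on continuous functions. -/
noncomputable def volterra (R : Type*) [NormedRing R] [NormedAlgebra ℂ R] {L : ℝ} (hL : 0 ≤ L) :
    C(Icc 0 L, R) →L[ℂ] C(Icc 0 L, R) :=
  have hc : ∀ f : C(Icc 0 L, R), Continuous fun t => f (projIcc 0 L hL t) := fun f =>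
    f.continuous.comp continuous_projIcc
  LinearMap.mkContinuous
    { toFun := fun f => ⟨fun x => ∫ t in (0 : ℝ)..x, f (projIcc 0 L hL t),
        (intervalIntegral.continuous_primitive
          (fun a b => (hc f).intervalIntegrable a b) 0).comp continuous_subtype_val⟩
      map_add' := fun f g => by
        ext x
        exact intervalIntegral.integral_add ((hc f).intervalIntegrable _ _)
          ((hc g).intervalIntegrable _ _)
      map_smul' := fun c f => by
        ext x
        exact intervalIntegral.integral_smul c _ } L fun f => by
    refine (ContinuousMap.norm_le _ (mul_nonneg hL (norm_nonneg _))).2 fun x => ?_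
    refine (intervalIntegral.norm_integral_le_of_norm_le_const
      (C := ‖f‖) fun t _ => f.norm_coe_le_norm _).trans ?_
    rw [sub_zero, abs_of_nonneg x.2.1, mul_comm]
    exact mul_le_mul_of_nonneg_right x.2.2 (norm_nonneg _)

theorem volterra_apply (hL : 0 ≤ L) (f : C(Icc 0 L, R)) (x : Icc 0 L) :
    volterra R hL f x = ∫ t in (0 : ℝ)..x, f (projIcc 0 L hL t) := rfl

/-- A solution of `(1 - (w - z) K) y = c` depends holomorphically on `w` near `z`, where
`1 - (w - z) K` is invertible. -/
theorem differentiableAt_of_sub_smul_eq {E : Type*} [NormedAddCommGroup E] [NormedSpace ℂ E]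
    [CompleteSpace E] (K : E →L[ℂ] E) {y : ℂ → E} {c : E} {z : ℂ}
    (h : ∀ w, y w - (w - z) • K (y w) = c) : DifferentiableAt ℂ y z := by
  have hT : DifferentiableAt ℂ (fun w : ℂ => 1 - (w - z) • K) z :=
    ((differentiableAt_id.sub_const z).smul_const K).const_sub 1
  have hunit : IsUnit (1 - (z - z) • K) := by
    rw [sub_self, zero_smul, sub_zero]
    exact isUnit_one
  have hev : ∀ᶠ w in nhds z, IsUnit (1 - (w - z) • K) :=
    hT.continuousAt.eventually (Units.isOpen.mem_nhds hunit)
  have hinv : DifferentiableAt ℂ (fun w : ℂ => Ring.inverse (1 - (w - z) • K)) z :=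
    DifferentiableAt.comp (g := Ring.inverse) (f := fun w : ℂ => 1 - (w - z) • K) z
      (differentiableAt_inverse hunit) hT
  refine (hinv.clm_apply (differentiableAt_const c)).congr_of_eventuallyEq (hev.mono fun w hw => ?_)
  have h2 := congrArg (fun S : E →L[ℂ] E => S (y w)) (Ring.inverse_mul_cancel _ hw)
  rw [← h w]
  exact h2.symm

/-- The fundamental solution of a linear equation whose coefficient is affine in a parameter
depends holomorphically on the parameter, uniformly in `x`, and so does its inverse. Near `z`, the
quotient `Y = U(z)⁻¹ U(w)` solves `(1 - (w - z) K) Y = 1` with a fixed bounded operator `K`. -/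
theorem differentiable_solution [CompleteSpace R] (hL : 0 ≤ L) {A : ℂ → ℝ → R} {B : ℝ → R}
    {U V : ℂ → ℝ → R} (hB : ContinuousOn B (Icc 0 L))
    (hA : ∀ z w, ∀ x ∈ Icc 0 L, A w x - A z x = (w - z) • B x)
    (hU0 : ∀ z, U z 0 = 1) (hV0 : ∀ z, V z 0 = 1)
    (hU : ∀ z, ∀ x ∈ Icc 0 L, HasDerivWithinAt (U z) (A z x * U z x) (Icc 0 L) x)
    (hV : ∀ z, ∀ x ∈ Icc 0 L, HasDerivWithinAt (V z) (-(V z x * A z x)) (Icc 0 L) x)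
    (hVU : ∀ z, ∀ x ∈ Icc 0 L, V z x * U z x = 1) (hUV : ∀ z, ∀ x ∈ Icc 0 L, U z x * V z x = 1)
    {u v : ℂ → C(Icc 0 L, R)} (hu : ∀ z x, u z x = U z x) (hv : ∀ z x, v z x = V z x) :
    Differentiable ℂ u ∧ Differentiable ℂ v := by
  have hvu : ∀ z, v z * u z = 1 := fun z => by
    ext x
    rw [ContinuousMap.mul_apply, hv, hu, hVU z x x.2, ContinuousMap.one_apply]
  have huv : ∀ z, u z * v z = 1 := fun z => by
    ext x
    rw [ContinuousMap.mul_apply, hv, hu, hUV z x x.2, ContinuousMap.one_apply]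
  have hUc : ∀ z, ContinuousOn (U z) (Icc 0 L) := fun z x hx => (hU z x hx).continuousWithinAt
  have hVc : ∀ z, ContinuousOn (V z) (Icc 0 L) := fun z x hx => (hV z x hx).continuousWithinAt
  let b : C(Icc 0 L, R) := ⟨(Icc 0 L).domRestrict B, hB.domRestrict⟩
  have hdu : Differentiable ℂ u := by
    intro z
    let K : C(Icc 0 L, R) →L[ℂ] C(Icc 0 L, R) :=
      (volterra R hL).comp (ContinuousLinearMap.mul ℂ C(Icc 0 L, R) (v z * b * u z))
    have key : ∀ w, v z * u w - (w - z) • K (v z * u w) = 1 := by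
      intro w
      have hder : ∀ x ∈ Icc 0 L, HasDerivWithinAt (fun t => V z t * U w t)
          ((w - z) • (V z x * B x * U w x)) (Icc 0 L) x := by
        intro x hx
        refine ((hV z x hx).mul (hU w x hx)).congr_deriv ?_
        have : (w - z) • (V z x * B x * U w x) = V z x * ((w - z) • B x) * U w x := by
          rw [mul_smul_comm, smul_mul_assoc]
        rw [this, ← hA z w x hx]
        noncomm_ring
      ext x
      have hftc := eq_add_integral_of_hasDerivWithinAt hder
        ((((hVc z).mul hB).mul (hUc w)).const_smul (w - z)) x x.2
      rw [intervalIntegral.integral_smul, hV0, hU0, one_mul] at hftc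
      have hK : K (v z * u w) x = ∫ t in (0 : ℝ)..x, V z t * B t * U w t := by
        change volterra R hL (v z * b * u z * (v z * u w)) x = _
        have : v z * b * u z * (v z * u w) = v z * b * u w := by
          rw [mul_assoc, ← mul_assoc (u z), huv, one_mul]
        rw [this, volterra_apply]
        refine intervalIntegral.integral_congr fun t ht => ?_
        rw [uIcc_of_le x.2.1] at ht
        have ht' : t ∈ Icc 0 L := ⟨ht.1, ht.2.trans x.2.2⟩
        simp only [projIcc_of_mem hL ht', ContinuousMap.mul_apply, hv, hu]
        rfl
      change v z x * u w x - (w - z) • K (v z * u w) x = 1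
      rw [hK, hv, hu, hftc, add_sub_cancel_right]
    have hu_eq : u = fun w => u z * (v z * u w) := funext fun w => by
      rw [← mul_assoc, huv, one_mul]
    rw [hu_eq]
    exact (differentiableAt_of_sub_smul_eq K key).const_mul _
  refine ⟨hdu, ?_⟩
  have hinv : v = fun z => Ring.inverse (u z) := by
    funext z
    exact (Ring.inverse_unit ⟨u z, v z, huv z, hvu z⟩).symm
  rw [hinv]
  intro z
  exact (differentiableAt_inverse ⟨⟨u z, v z, huv z, hvu z⟩, rfl⟩).comp z (hdu z)

theorem differentiable_comp_left {E F α : Type*} [NormedAddCommGroup E] [NormedSpace ℂ E]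
    [NormedAddCommGroup F] [NormedSpace ℂ F] [TopologicalSpace α] [CompactSpace α] (e : E →L[ℂ] F)
    {u : ℂ → C(α, E)} (hu : Differentiable ℂ u) :
    Differentiable ℂ fun z => (⟨fun x => e (u z x), by fun_prop⟩ : C(α, F)) :=
  (e.compLeftContinuous ℂ α).differentiable.comp hu

end Volterra

namespace DiffExpr

variable {d : ℕ} (D : DiffExpr d)

/-- The entry `(i, j)` of the fundamental matrix as a continuous function of `x`. -/
noncomputable def fundamentalMap (i j : Fin (d + 1)) (z : ℂ) : C(Icc 0 D.len, ℂ) :=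
  ⟨fun x => D.fundamental z x i j, (continuousOn_fundamental z i j).domRestrict⟩

/-- The entry `(i, j)` of the inverse of the fundamental matrix as a continuous function of `x`. -/
noncomputable def fundamentalInvMap (i j : Fin (d + 1)) (z : ℂ) : C(Icc 0 D.len, ℂ) :=
  ⟨fun x => (D.fundamental z x)⁻¹ i j, (continuousOn_fundamental_inv z i j).domRestrict⟩

section

attribute [local instance] Matrix.linftyOpNormedRing Matrix.linftyOpNormedAlgebra

theorem differentiable_fundamentalMap (i j : Fin (d + 1)) :
    Differentiable ℂ (D.fundamentalMap i j) ∧ Differentiable ℂ (D.fundamentalInvMap i j) := by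
  have hL := D.len_pos.le
  -- The coefficient of the spectral parameter in the companion matrix.
  let B : ℝ → Matrix (Fin (d + 1)) (Fin (d + 1)) ℂ := fun x i j =>
    if i = Fin.last d ∧ j = 0 then (D.lead x)⁻¹ else 0
  have hB : ContinuousOn B (Icc 0 D.len) := by
    refine continuousOn_pi.2 fun i => continuousOn_pi.2 fun j => ?_
    by_cases h : i = Fin.last d ∧ j = 0
    · simp only [B, if_pos h]
      exact D.lead_cont.inv₀ D.lead_ne
    · simp only [B, if_neg h]
      exact continuousOn_const
  let u : ℂ → C(Icc 0 D.len, Matrix (Fin (d + 1)) (Fin (d + 1)) ℂ) := fun z =>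
    ⟨fun x => D.fundamental z x, continuous_pi fun i => continuous_pi fun j =>
      (D.fundamentalMap i j z).continuous⟩
  let v : ℂ → C(Icc 0 D.len, Matrix (Fin (d + 1)) (Fin (d + 1)) ℂ) := fun z =>
    ⟨fun x => (D.fundamental z x)⁻¹, continuous_pi fun i => continuous_pi fun j =>
      (D.fundamentalInvMap i j z).continuous⟩
  have hU := fun z => D.isFundamentalMatrix_fundamental z
  have hA := D.continuousOn_companion
  have key : Differentiable ℂ u ∧ Differentiable ℂ v :=
    differentiable_solution hL (A := D.companion) (B := B) (U := D.fundamental)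
      (V := fun z x => (D.fundamental z x)⁻¹) hB
      (fun z w x hx => by
        ext i j
        change D.companion w x i j - D.companion z x i j = (w - z) * B x i j
        simp only [companion, B]
        by_cases hi : i = Fin.last d <;> by_cases hj : j = 0 <;> simp [hi, hj]
        ring)
      (fun z => (hU z).1) (fun z => by rw [(hU z).1, inv_one])
      (fun z x hx => (hU z).hasDerivWithinAt hx)
      (fun z x hx => (hU z).hasDerivWithinAt_inv hL (hA z) hx)
      (fun z x hx => (hU z).inv_mul hL (hA z) hx) (fun z x hx => (hU z).mul_inv hL (hA z) hx)
      (fun _ _ => rfl) (fun _ _ => rfl)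
  let e : Matrix (Fin (d + 1)) (Fin (d + 1)) ℂ →L[ℂ] ℂ :=
    ⟨Matrix.entryLinearMap ℂ ℂ i j, (continuous_apply j).comp (continuous_apply i)⟩
  exact ⟨differentiable_comp_left e key.1, differentiable_comp_left e key.2⟩

end

end DiffExpr

section MatrixDifferentiable

variable {ι : Type*} [Fintype ι] [DecidableEq ι]

theorem differentiable_det {A : ℂ → Matrix ι ι ℂ}
    (hA : ∀ i j, Differentiable ℂ fun z => A z i j) : Differentiable ℂ fun z => (A z).det := by
  simp only [Matrix.det_apply]
  exact Differentiable.fun_sum fun σ _ =>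
    (Differentiable.fun_finsetProd fun i _ => hA (σ i) i).const_smul _

theorem differentiable_adjugate {A : ℂ → Matrix ι ι ℂ}
    (hA : ∀ i j, Differentiable ℂ fun z => A z i j) (i j : ι) :
    Differentiable ℂ fun z => (A z).adjugate i j := by
  simp only [Matrix.adjugate_apply]
  refine differentiable_det fun k l => ?_
  by_cases hk : k = j
  · subst hk
    simp only [Matrix.updateRow_self]
    exact differentiable_const _
  · simp only [Matrix.updateRow_ne hk]
    exact hA k l

theorem differentiable_matrix_mul {κ μ ν : Type*} [Fintype μ] {A : ℂ → Matrix κ μ ℂ}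
    {B : ℂ → Matrix μ ν ℂ} (hA : ∀ i j, Differentiable ℂ fun z => A z i j)
    (hB : ∀ i j, Differentiable ℂ fun z => B z i j) (i : κ) (j : ν) :
    Differentiable ℂ fun z => (A z * B z) i j := by
  simp only [Matrix.mul_apply]
  exact Differentiable.fun_sum fun k _ => (hA i k).mul (hB k j)

end MatrixDifferentiable

namespace BoundaryCondition

variable {d : ℕ} {M : ℂ → Matrix (Fin (d + 1)) (Fin (d + 1)) ℂ}

theorem differentiable_evans (bc : BoundaryCondition d)
    (hM : ∀ i j, Differentiable ℂ fun z => M z i j) : Differentiable ℂ fun z => bc.evans (M z) := by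
  cases bc with
  | separated S =>
    exact differentiable_det (differentiable_matrix_mul (differentiable_matrix_mul
      (fun _ _ => differentiable_const _) hM) fun _ _ => differentiable_const _)
  | periodic => exact differentiable_det fun i j => (hM i j).sub_const _

theorem differentiable_projMatrix (bc : BoundaryCondition d)
    (hM : ∀ i j, Differentiable ℂ fun z => M z i j) (i j : Fin (d + 1)) :
    Differentiable ℂ fun z => bc.projMatrix (M z) i j := by
  cases bc with
  | separated S =>
    have hconst : ∀ {κ μ : Type} (A : Matrix κ μ ℂ) (i : κ) (j : μ),
      Differentiable ℂ fun _ : ℂ => A i j := fun _ _ _ => differentiable_const _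
    exact differentiable_matrix_mul (differentiable_matrix_mul (differentiable_matrix_mul
      (hconst _) (differentiable_adjugate (differentiable_matrix_mul (differentiable_matrix_mul
      (hconst _) hM) (hconst _)))) (hconst _)) hM i j
  | periodic =>
    exact differentiable_matrix_mul (differentiable_adjugate fun i j => (hM i j).sub_const _) hM i j

end BoundaryCondition

theorem differentiable_comp_right {α β : Type*} [TopologicalSpace α] [CompactSpace α]
    [TopologicalSpace β] [CompactSpace β] (f : C(β, α)) {u : ℂ → C(α, ℂ)}
    (hu : Differentiable ℂ u) : Differentiable ℂ fun z => (u z).comp f := by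
  let e : C(α, ℂ) →L[ℂ] C(β, ℂ) :=
    ⟨(ContinuousMap.compRightAlgHom ℂ ℂ f).toLinearMap, ContinuousMap.continuous_precomp f⟩
  exact e.differentiable.comp hu

namespace DiffExpr

variable {d : ℕ} (D : DiffExpr d)

theorem differentiable_monodromy (i j : Fin (d + 1)) :
    Differentiable ℂ fun z => D.monodromy z i j := by
  let e : C(Icc 0 D.len, ℂ) →L[ℂ] ℂ := ContinuousMap.evalCLM ℂ ⟨D.len, D.len_pos.le, le_rfl⟩
  exact e.differentiable.comp (D.differentiable_fundamentalMap i j).1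

/-- The function `1 / lead` as a continuous function on the interval. -/
noncomputable def leadInvMap : C(Icc 0 D.len, ℂ) :=
  ⟨fun x => (D.lead x)⁻¹, (D.lead_cont.inv₀ D.lead_ne).domRestrict⟩

/-- The kernel `matKernel` as a continuous function on the square, assembled from the entries of
the fundamental matrix and its inverse. -/
noncomputable def kernelMap (z : ℂ) (Q : Matrix (Fin (d + 1)) (Fin (d + 1)) ℂ) :
    C(Icc 0 D.len × Icc 0 D.len, ℂ) :=
  ∑ j, (∑ k, Q k j • (D.fundamentalMap 0 k z).comp ContinuousMap.fst) *
    ((D.fundamentalInvMap j (Fin.last d) z).comp ContinuousMap.snd *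
      D.leadInvMap.comp ContinuousMap.snd)

theorem kernelMap_apply (z : ℂ) (Q : Matrix (Fin (d + 1)) (Fin (d + 1)) ℂ)
    (p : Icc 0 D.len × Icc 0 D.len) : D.kernelMap z Q p = D.matKernel z Q p.1 p.2 := by
  rw [matKernel_eq_sum, kernelMap, ContinuousMap.sum_apply]
  refine Finset.sum_congr rfl fun j _ => ?_
  rw [ContinuousMap.mul_apply, ContinuousMap.sum_apply, Matrix.mul_apply]
  refine congrArg₂ (· * ·) (Finset.sum_congr rfl fun k _ => ?_) rfl
  exact mul_comm _ _

theorem differentiable_kernelMap {Q : ℂ → Matrix (Fin (d + 1)) (Fin (d + 1)) ℂ}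
    (hQ : ∀ i j, Differentiable ℂ fun z => Q z i j) :
    Differentiable ℂ fun z => D.kernelMap z (Q z) := by
  unfold kernelMap
  refine Differentiable.fun_sum fun j _ => Differentiable.mul
    (Differentiable.fun_sum fun k _ => (hQ k j).smul ?_) (Differentiable.mul_const ?_ _)
  · exact differentiable_comp_right _ (D.differentiable_fundamentalMap 0 k).1
  · exact differentiable_comp_right _ (D.differentiable_fundamentalMap j (Fin.last d)).2

/-- Integration of a continuous function on the square over the part of it lying in `S`. The
function is extended to the plane by projecting to the square, which leaves the integral
unchanged. -/
noncomputable def squareIntegral (S : Set (ℝ × ℝ)) :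
    C(Icc 0 D.len × Icc 0 D.len, ℂ) →L[ℂ] ℂ :=
  have hc : ∀ f : C(Icc 0 D.len × Icc 0 D.len, ℂ), Continuous fun p : ℝ × ℝ =>
      f (projIcc 0 D.len D.len_pos.le p.1, projIcc 0 D.len D.len_pos.le p.2) := fun f =>
    f.continuous.comp ((continuous_projIcc.comp continuous_fst).prodMk
      (continuous_projIcc.comp continuous_snd))
  have hi : ∀ f : C(Icc 0 D.len × Icc 0 D.len, ℂ), Integrable (fun p : ℝ × ℝ =>
      f (projIcc 0 D.len D.len_pos.le p.1, projIcc 0 D.len D.len_pos.le p.2))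
      ((D.vol.prod D.vol).restrict S) := fun f =>
    Integrable.of_bound (hc f).aestronglyMeasurable ‖f‖
      (Filter.Eventually.of_forall fun _ => f.norm_coe_le_norm _)
  LinearMap.mkContinuous
    { toFun := fun f => ∫ p in S, f (projIcc 0 D.len D.len_pos.le p.1,
        projIcc 0 D.len D.len_pos.le p.2) ∂(D.vol.prod D.vol)
      map_add' := fun f g => integral_add (hi f) (hi g)
      map_smul' := fun c _ => integral_const_mul c _ }
    (((D.vol.prod D.vol).restrict S).real univ) fun f => by
    rw [mul_comm]
    exact norm_integral_le_of_norm_le_const (Filter.Eventually.of_forall fun _ =>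
      f.norm_coe_le_norm _)

theorem re_squareIntegral_star_mul (S : Set (ℝ × ℝ)) (z : ℂ)
    (Q : Matrix (Fin (d + 1)) (Fin (d + 1)) ℂ) :
    (D.squareIntegral S (star (D.kernelMap z Q) * D.kernelMap z Q)).re =
      ∫ p in S, ‖D.matKernel z Q p.1 p.2‖ ^ 2 ∂(D.vol.prod D.vol) := by
  have h : D.squareIntegral S (star (D.kernelMap z Q) * D.kernelMap z Q) =
      ∫ p in S, ((‖D.matKernel z Q p.1 p.2‖ ^ 2 : ℝ) : ℂ) ∂(D.vol.prod D.vol) := by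
    refine integral_congr_ae (ae_restrict_of_ae ?_)
    rw [vol_prod]
    filter_upwards [ae_restrict_mem (measurableSet_Icc.prod measurableSet_Icc)] with p hp
    rw [projIcc_of_mem _ hp.1, projIcc_of_mem _ hp.2]
    rw [ContinuousMap.mul_apply, ContinuousMap.star_apply, kernelMap_apply, Complex.star_def,
      Complex.conj_mul']
    norm_cast
  rw [h, integral_complex_ofReal, Complex.ofReal_re]

/-- The square of the weight is a sesquilinear expression in the kernels on the two sides of the
diagonal. -/
theorem weight_sq_eq (bc : BoundaryCondition d) (z : ℂ) : D.weight bc z ^ 2 =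
    (D.squareIntegral {p | p.2 < p.1} (star (D.kernelMap z (D.lowerMatrix bc z)) *
      D.kernelMap z (D.lowerMatrix bc z))).re +
    (D.squareIntegral {p | p.2 < p.1}ᶜ (star (D.kernelMap z (D.upperMatrix bc z)) *
      D.kernelMap z (D.upperMatrix bc z))).re := by
  have hsq : Integrable (fun p : ℝ × ℝ => ‖D.green bc z p.1 p.2‖ ^ 2) (D.vol.prod D.vol) :=
    (memLp_two_iff_integrable_sq_norm (D.memLp_green bc z).aestronglyMeasurable).1
      (D.memLp_green bc z)
  rw [weight_sq, ← integral_prod _ hsq, ← integral_add_compl measurableSet_lower hsq,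
    re_squareIntegral_star_mul, re_squareIntegral_star_mul]
  refine congrArg₂ (· + ·) (setIntegral_congr_fun measurableSet_lower fun p hp => ?_)
    (setIntegral_congr_fun measurableSet_lower.compl fun p hp => ?_)
  · simp only [green_eq_ite, if_pos (show p.2 < p.1 from hp)]
  · simp only [green_eq_ite, if_neg (show ¬ p.2 < p.1 from hp)]

theorem analyticAt_re_squareIntegral (S : Set (ℝ × ℝ))
    {Q : ℂ → Matrix (Fin (d + 1)) (Fin (d + 1)) ℂ}
    (hQ : ∀ i j, Differentiable ℂ fun z => Q z i j) (z : ℂ) :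
    AnalyticAt ℝ (fun w => (D.squareIntegral S
      (star (D.kernelMap w (Q w)) * D.kernelMap w (Q w))).re) z := by
  have hk : AnalyticAt ℝ (fun w => D.kernelMap w (Q w)) z :=
    ((D.differentiable_kernelMap hQ).analyticAt z).restrictScalars
  have hs : AnalyticAt ℝ (fun w => star (D.kernelMap w (Q w))) z :=
    ((starL' ℝ : C(Icc 0 D.len × Icc 0 D.len, ℂ) ≃L[ℝ] _).toContinuousLinearMap.analyticAt _).comp hk
  exact ((Complex.reCLM.comp ((D.squareIntegral S).restrictScalars ℝ)).analyticAt _).comp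
    (hs.mul hk)

theorem analyticAt_weight_sq (bc : BoundaryCondition d) (z : ℂ) :
    AnalyticAt ℝ (fun w => D.weight bc w ^ 2) z := by
  have hM := D.differentiable_monodromy
  have hP := bc.differentiable_projMatrix hM
  have hlower : ∀ i j, Differentiable ℂ fun w => D.lowerMatrix bc w i j := fun i j =>
    ((bc.differentiable_evans hM).mul_const _).sub (hP i j)
  have hupper : ∀ i j, Differentiable ℂ fun w => D.upperMatrix bc w i j := fun i j => (hP i j).neg
  simp only [weight_sq_eq]
  exact (D.analyticAt_re_squareIntegral _ hlower z).add (D.analyticAt_re_squareIntegral _ hupper z)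

theorem analyticAt_weight (bc : BoundaryCondition d) {z : ℂ} (hz : D.weight bc z ≠ 0) :
    AnalyticAt ℝ (D.weight bc) z := by
  have e : D.weight bc = fun w => Real.sqrt (D.weight bc w ^ 2) :=
    funext fun w => (Real.sqrt_sq (D.weight_nonneg bc w)).symm
  rw [e]
  have hsqrt : AnalyticAt ℝ Real.sqrt (D.weight bc z ^ 2) :=
    (Real.contDiffAt_sqrt (pow_ne_zero 2 hz)).analyticAt
  exact AnalyticAt.comp (g := Real.sqrt) (f := fun w => D.weight bc w ^ 2) hsqrt
    (D.analyticAt_weight_sq bc z)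

end DiffExpr

theorem mainTheorem1 {d : ℕ} (D : DiffExpr d) (bc : BoundaryCondition d) :
    (∀ z : ℂ, z ∈ unboundedResolventSet (D.operator bc) ↔ D.evans bc z ≠ 0) ∧
    (∀ (z : ℂ) (R : D.H →L[ℂ] D.H), IsResolventAt (D.operator bc) z R →
      0 < D.weight bc z ∧ ‖R‖ ≤ D.weight bc z / ‖D.evans bc z‖) ∧
    (∀ z ∈ unboundedResolventSet (D.operator bc), ∀ w : ℂ,
      ‖w - z‖ < ‖D.evans bc z / (D.weight bc z : ℂ)‖ →
        w ∈ unboundedResolventSet (D.operator bc)) ∧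
    (∀ z : ℂ, AnalyticAt ℝ (fun w : ℂ => D.weight bc w ^ 2) z) ∧
    (∀ z : ℂ, D.weight bc z ≠ 0 → AnalyticAt ℝ (D.weight bc) z) := by
  refine ⟨fun z => ⟨fun ⟨R, hR⟩ => DiffExpr.evans_ne_zero hR, fun hE => ?_⟩,
    fun z R hR => ⟨DiffExpr.weight_pos hR, DiffExpr.norm_resolvent_le hR⟩, ?_,
    D.analyticAt_weight_sq bc, fun z hz => D.analyticAt_weight bc hz⟩
  · obtain ⟨R, hR, -⟩ := DiffExpr.exists_resolvent hE
    exact ⟨R, hR⟩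
  · rintro z ⟨R, hR⟩ w hw
    refine hR.mem_of_norm_lt ?_
    have hW := DiffExpr.weight_pos hR
    have hE : 0 < ‖D.evans bc z‖ := norm_pos_iff.2 (DiffExpr.evans_ne_zero hR)
    rw [norm_div, Complex.norm_real, Real.norm_of_nonneg hW.le] at hw
    calc ‖w - z‖ * ‖R‖ ≤ ‖w - z‖ * (D.weight bc z / ‖D.evans bc z‖) :=
          mul_le_mul_of_nonneg_left (DiffExpr.norm_resolvent_le hR) (norm_nonneg _)
      _ < ‖D.evans bc z‖ / D.weight bc z * (D.weight bc z / ‖D.evans bc z‖) :=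
          mul_lt_mul_of_pos_right hw (div_pos hW hE)
      _ = 1 := by field_simp
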